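/- Fix a horizon $T>0$. Let $U,V$ be nonempty compact metric spaces, let $f:[0,T]\times\mathbb R^d\times U\times V\to\mathbb R^d$ be continuous, bounded by $M$ (in Euclidean norm) and Lipschitz in $x$ with constant $K_f$, uniformly in the other variables, and let $g:\mathbb R^d\to\mathbb R$ be bounded and Lipschitz with constant $K_g$. Let $(\Omega,\mathcal F,P)=\big(([0,1]^2)^{\mathbb N},\mathcal B([0,1]^2)^{\otimes\mathbb N},\lambda_2^{\otimes\mathbb N}\big)$ with coordinates $\zeta_j=(\zeta_{j,1},\zeta_{j,2})$, $j\ge1$, and put $\mathcal F_j=\sigma(\zeta_1,\dots,\zeta_j)$ ($\mathcal F_0$ trivial), $\mathcal G_j=\sigma(\zeta_{j,1})$, $\mathcal H_j=\sigma(\zeta_{j,2})$. Let $\Pi=\{0=t_0<t_1<\dots<t_n=T\}$ be a partition of $[0,T]$. *Controls.* An admissible control $u$ of Player 1 along $\Pi$ is a measurable $U$-valued process on $[0,T]\times\Omega$ which on each interval $[t_{j-1},t_j)$, $1\le j\le n$, has the form $\sum_{k\ge1}I_{\Gamma_{j,k}}u^{j,k}$, where $(\Gamma_{j,k})_{k\ge1}\subset\mathcal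 F_{j-1}$ is a partition of $\Omega$ and the $u^{j,k}$ are measurable $U$-valued processes with $u^{j,k}_s$ $\mathcal G_j$-measurable for all $s$. Admissible controls $v$ of Player 2 are defined likewise, with $V$ and $\mathcal H_j$ in place of $U$ and $\mathcal G_j$. Admissible controls over $[t,T]$ are the restrictions of these to $[t,T]$. *Strategies.* An NAD-strategy (nonanticipative with delay) $\beta$ of Player 2 over $[t,T]$ maps Player 1's admissible controls over $[t,T]$ to Player 2's such that, for every stopping time $\tau:\Omega\to\{0,\dots,n-1\}$ of $(\mathcal F_j)_{j\ge 0}$: if $u=u'$ $ds\,dP$-a.e. on $\{(s,\omega): t\le s\le t_{\tau(\omega)}\}$, then $\beta(u)=\beta(u')$ $ds\,dP$-a.e. on $\{(s,\omega): s\in[t,T],\ s\le t_{\tau(\omega)+1}\}$. NAD-strategies $\alpha$ of Player 1 are defined symmetrically. Let $\mathcal A^\Pi_{t,T}$, $\mathcal B^\Pi_{t,T}$ be the sets of NAD-strategies over $[t,T]$ of Players 1 and 2. To each $(\alpha,\beta)\in\mathcal A^\Pi_{t,T}\times\mathcal B^\Pi_{t,T}$ belongs a $ds\,dP$-a.e.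 unique couple $(u,v)$ of admissible controls over $[t,T]$ with $\alpha(v)=u$, $\beta(u)=v$ $ds\,dP$-a.e.; $X^{t,x,\alpha,\beta}$ is the pathwise solution of $X_s=x+\int_t^s f(r,X_r,u_r,v_r)\,dr$, $s\in[t,T]$. *Values.* For $(t,x)\in[0,T]\times\mathbb R^d$, with $t_i\le t<t_{i+1}$ (and $i=n$ if $t=T$), put $$V^\Pi(t,x)=\operatorname*{esssup}_{\alpha\in\mathcal A^\Pi_{t,T}}\operatorname*{essinf}_{\beta\in\mathcal B^\Pi_{t,T}}E\big[g(X_T^{t,x,\alpha,\beta})\,\big|\,\mathcal F_i\big],\qquad U^\Pi(t,x)=\operatorname*{essinf}_{\beta\in\mathcal B^\Pi_{t,T}}\operatorname*{esssup}_{\alpha\in\mathcal A^\Pi_{t,T}}E\big[g(X_T^{t,x,\alpha,\beta})\,\big|\,\mathcal F_i\big].$$ **Lemma.** There is a real constant $L$ depending only on $T$, $M$, $K_f$ and $K_g$ (not on $d,U,V$, nor otherwise on $f,g$) such that, for every partition $\Pi$ of $[0,T]$ and all $(t,x),(t',x')\in[0,T]\times\mathbb R^d$, $$|V^\Pi(t,x)-V^\Pi(t',x')|+|U^\Pi(t,x)-U^\Pi(t',x')|\le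 L\,(|t-t'|+|x-x'|).$$ This holds $P$-a.s. for the random variables $V^\Pi(t,x)$, $U^\Pi(t,x)$ just defined, and also for their deterministic versions $E[V^\Pi(t,x)]$, $E[U^\Pi(t,x)]$. -/

import Mathlib

open MeasureTheory Set Filter

namespace MixedGame

/-! ### The randomization space -/

/-- `Ω = ([0,1]²)^ℕ`.  Coordinates are numbered from `0`: `ω j` is the pair
`(ζ_{j+1,1}(ω), ζ_{j+1,2}(ω))`, the randomness that the two players use on the time interval
`[t_j, t_{j+1})` of a partition. -/
abbrev Omega : Type := ℕ → unitInterval × unitInterval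

/-- The product of countably many copies of the two-dimensional Lebesgue measure on `[0,1]²`. -/
noncomputable abbrev P : Measure Omega :=
  Measure.infinitePi (fun _ : ℕ => (volume : Measure (unitInterval × unitInterval)))

/-- The σ-field of the first `j` coordinates, `F_j = σ(ζ_1, …, ζ_j)`; `F_0` is trivial. -/
def pastField (j : ℕ) : MeasurableSpace Omega :=
  ⨆ i ∈ Iio j, MeasurableSpace.comap (fun ω : Omega => ω i) inferInstance

/-- The σ-field generated by `ζ_{j+1,1}`: Player 1's private randomness on `[t_j, t_{j+1})`. -/
def privateField₁ (j : ℕ) : MeasurableSpace Omega :=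
  MeasurableSpace.comap (fun ω : Omega => (ω j).1) inferInstance

/-- The σ-field generated by `ζ_{j+1,2}`: Player 2's private randomness on `[t_j, t_{j+1})`. -/
def privateField₂ (j : ℕ) : MeasurableSpace Omega :=
  MeasurableSpace.comap (fun ω : Omega => (ω j).2) inferInstance

theorem pastField_le (j : ℕ) :
    pastField j ≤ (inferInstance : MeasurableSpace Omega) := by
  refine iSup₂_le fun i _ => ?_
  exact (measurable_pi_apply i).comap_le

/-! ### Partitions -/

/-- A partition `0 = t_0 < t_1 < ⋯ < t_n = T`.  Only the values `node j` with `j ≤ n` matter. -/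
structure TimePartition (T : ℝ) where
  n : ℕ
  node : ℕ → ℝ
  node_zero : node 0 = 0
  node_lt : ∀ j < n, node j < node (j + 1)
  node_last : node n = T

/-- The largest `i ≤ n` with `t_i ≤ t`.  So `t_i ≤ t < t_{i+1}` for `0 ≤ t < T`, and `i = n`
for `t = T`. -/
noncomputable def TimePartition.index {T : ℝ} (π : TimePartition T) (t : ℝ) : ℕ :=
  open Classical in Nat.findGreatest (fun i => π.node i ≤ t) π.n

/-! ### Admissible controls -/

section Controls

variable {T : ℝ} (π : TimePartition T) (𝒦 : ℕ → MeasurableSpace Omega)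
  {A : Type*} [MeasurableSpace A]

/-- Admissible controls with values in `A` along a partition, `𝒦` being the private σ-fields of
the player: a measurable process which on each `[t_j, t_{j+1})` is of the form
`∑ₖ 1_{Γ_k} w^k`, with an `F_j`-measurable countable partition `(Γ_k)` of `Ω` and
measurable processes `w^k` such that each `w^k_s` is `𝒦 j`-measurable.  Only the values of the
process at times in `[0,T]` matter. -/
structure IsAdmissible (u : ℝ → Omega → A) : Prop where
  measurable : Measurable (fun p : ℝ × Omega => u p.1 p.2)
  piecewise : ∀ j < π.n, ∃ (Γ : ℕ → Set Omega) (w : ℕ → ℝ → Omega → A),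
    (∀ k, MeasurableSet[pastField j] (Γ k)) ∧
    Pairwise (fun k l => Disjoint (Γ k) (Γ l)) ∧
    (⋃ k, Γ k) = univ ∧
    (∀ k, Measurable (fun p : ℝ × Omega => w k p.1 p.2)) ∧
    (∀ k s, Measurable[𝒦 j] (w k s)) ∧
    ∀ k, ∀ s ∈ Ico (π.node j) (π.node (j + 1)), ∀ ω ∈ Γ k, u s ω = w k s ω

variable (A) in
/-- The admissible controls along `π`.  The controls over a smaller time interval `[t,T]` are the
restrictions of these to `[t,T]`; they are represented here by the unrestricted processes, and
nothing below looks at their values before `t`. -/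
abbrev Control : Type _ := {u : ℝ → Omega → A // IsAdmissible π 𝒦 u}

variable {π 𝒦} in
/-- `u = u'`, `ds dP`-a.e. on the stochastic interval `[[t, r]] = {(s,ω) | t ≤ s ≤ r ω}`. -/
def AgreeOn (t : ℝ) (r : Omega → ℝ) (u u' : Control π 𝒦 A) : Prop :=
  ∀ᵐ p ∂((volume : Measure ℝ).prod P), t ≤ p.1 → p.1 ≤ r p.2 → u.1 p.1 p.2 = u'.1 p.1 p.2

end Controls

/-! ### Nonanticipative strategies with delay -/

section Strategies

variable {T : ℝ} (π : TimePartition T) (t : ℝ)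

/-- Stopping times with values in `{0, …, n-1}` for the filtration `(F_j)`. -/
structure IsStopping (τ : Omega → ℕ) : Prop where
  lt : ∀ ω, τ ω < π.n
  meas : ∀ j, MeasurableSet[pastField j] {ω | τ ω = j}

/-- NAD-strategies over `[t,T]`, answering the controls of the opponent (values in `A`, private
σ-fields `𝒦`) by controls (values in `B`, private σ-fields `𝒦'`).  By the defining property, the
answer on `[t,T]` depends, up to `ds dP`-null sets, only on the restriction to `[t,T]` of
the opponent's control. -/
structure NADStrategy (𝒦 : ℕ → MeasurableSpace Omega) (A : Type*) [MeasurableSpace A]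
    (𝒦' : ℕ → MeasurableSpace Omega) (B : Type*) [MeasurableSpace B] where
  toFun : Control π 𝒦 A → Control π 𝒦' B
  nonanticipative : ∀ τ, IsStopping π τ → ∀ u u' : Control π 𝒦 A,
    AgreeOn t (fun ω => π.node (τ ω)) u u' →
      AgreeOn t (fun ω => π.node (τ ω + 1)) (toFun u) (toFun u')

variable (U V : Type*) [MeasurableSpace U] [MeasurableSpace V]

/-- NAD-strategies of Player 1 over `[t,T]`. -/
abbrev Strategy₁ := NADStrategy π t privateField₂ V privateField₁ U

/-- NAD-strategies of Player 2 over `[t,T]`. -/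
abbrev Strategy₂ := NADStrategy π t privateField₁ U privateField₂ V

variable {U V}

/-- The couple `(u,v)` of controls satisfies `α(v) = u`, `β(u) = v`, `ds dP`-a.e. on
`[t,T] × Ω`. -/
def IsOutcome {π : TimePartition T} {t : ℝ} (α : Strategy₁ π t U V) (β : Strategy₂ π t U V)
    (p : Control π privateField₁ U × Control π privateField₂ V) : Prop :=
  AgreeOn t (fun _ => T) (α.toFun p.2) p.1 ∧ AgreeOn t (fun _ => T) (β.toFun p.1) p.2

/-- Constant processes are admissible. -/
theorem isAdmissible_const (𝒦 : ℕ → MeasurableSpace Omega) {A : Type*} [MeasurableSpace A]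
    (a : A) : IsAdmissible π 𝒦 (fun _ _ => a) where
  measurable := measurable_const
  piecewise j _ := by
    refine ⟨fun k => if k = 0 then univ else ∅, fun _ _ _ => a, ?_, ?_, ?_, ?_, ?_, ?_⟩
    · intro k
      by_cases h : k = 0 <;> simp [h]
    · intro k l hkl
      rcases Nat.eq_zero_or_pos k with rfl | hk
      · simp [hkl.symm]
      · simp [hk.ne']
    · exact eq_univ_of_forall fun ω => mem_iUnion.2 ⟨0, by simp⟩
    · exact fun _ => measurable_const
    · exact fun _ _ => measurable_const
    · exact fun _ _ _ _ _ => rfl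

/-- Every couple of NAD-strategies has an outcome (it is `ds dP`-a.e. unique on `[t,T] × Ω`). -/
theorem exists_outcome [Nonempty U] [Nonempty V] {π : TimePartition T} {t : ℝ} (ht : 0 ≤ t)
    (α : Strategy₁ π t U V) (β : Strategy₂ π t U V) : ∃ p, IsOutcome α β p := by
  classical
  let p0 : Control π privateField₁ U × Control π privateField₂ V :=
    (⟨_, isAdmissible_const π _ (Classical.arbitrary U)⟩,
      ⟨_, isAdmissible_const π _ (Classical.arbitrary V)⟩)
  let q : ℕ → Control π privateField₁ U × Control π privateField₂ V :=
    fun j => Nat.rec p0 (fun _ p => (α.toFun p.2, β.toFun p.1)) j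
  have hq : ∀ j, q (j + 1) = (α.toFun (q j).2, β.toFun (q j).1) := fun j => rfl
  have key : ∀ j ≤ π.n, AgreeOn t (fun _ => π.node j) (q (j + 1)).1 (q j).1 ∧
      AgreeOn t (fun _ => π.node j) (q (j + 1)).2 (q j).2 := by
    intro j
    induction j with
    | zero =>
      intro _
      have h0 : ∀ᵐ p ∂((volume : Measure ℝ).prod P), p.1 ≠ 0 :=
        Measure.quasiMeasurePreserving_fst.ae (measure_eq_zero_iff_ae_notMem.1
          (measure_singleton (0 : ℝ)))
      constructor
      all_goals
        filter_upwards [h0] with p hp h1 h2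
        rw [π.node_zero] at h2
        exact absurd (le_antisymm h2 (ht.trans h1)) hp
    | succ j ih =>
      intro hj
      have hs : IsStopping π (fun _ => j) :=
        ⟨fun _ => hj, fun k => MeasurableSet.const _⟩
      obtain ⟨h1, h2⟩ := ih (by omega)
      rw [hq (j + 1)]
      refine ⟨?_, ?_⟩
      · have := α.nonanticipative _ hs _ _ h2
        rwa [hq j]
      · have := β.nonanticipative _ hs _ _ h1
        rwa [hq j]
  refine ⟨q π.n, ?_⟩
  have := key π.n le_rfl
  rw [hq, π.node_last] at this
  exact this

end Strategies

/-! ### Dynamics -/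

section Dynamics

/-- The state space `ℝ^d` with the Euclidean norm. -/
abbrev State (d : ℕ) := EuclideanSpace ℝ (Fin d)

variable {d : ℕ} {U V : Type*} (f : ℝ → State d → U → V → State d) (T : ℝ)

/-- `X` is, on `[t,T]`, a continuous solution of
`X_s = x + ∫_t^s f(r, X_r, a_r, b_r) dr` for the control paths `a`, `b`. -/
def IsTrajectory (t : ℝ) (x : State d) (a : ℝ → U) (b : ℝ → V) (X : ℝ → State d) : Prop :=
  ContinuousOn X (Icc t T) ∧
    ∀ s ∈ Icc t T, X s = x + ∫ r in t..s, f r (X r) (a r) (b r)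

open Classical in
/-- The state at time `s ∈ [t,T]` of the solution of the pathwise differential equation (which
exists and is unique for bounded, continuous `f`, Lipschitz in the state variable, and measurable
control paths; the value `x` for the case without solution is immaterial). -/
noncomputable def trajectory (t : ℝ) (x : State d) (a : ℝ → U) (b : ℝ → V) (s : ℝ) : State d :=
  if h : ∃ X, IsTrajectory f T t x a b X then h.choose s else x

end Dynamics

/-! ### Essential suprema and infima of families -/

section EssentialBounds

open Classical in
/-- The essential supremum of a family of random variables, i.e. its least upper bound for the
almost sure order on almost sure equivalence classes. It exists for the nonempty bounded families
that occur below; otherwise the value is `0`. -/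
noncomputable def essSupFamily {ι : Type*} (F : ι → Omega →ₘ[P] ℝ) : Omega →ₘ[P] ℝ :=
  if h : ∃ Y, IsLUB (range F) Y then h.choose else 0

open Classical in
/-- The essential infimum of a family of random variables, i.e. its greatest lower bound for the
almost sure order on almost sure equivalence classes. It exists for the nonempty bounded families
that occur below; otherwise the value is `0`. -/
noncomputable def essInfFamily {ι : Type*} (F : ι → Omega →ₘ[P] ℝ) : Omega →ₘ[P] ℝ :=
  if h : ∃ Y, IsGLB (range F) Y then h.choose else 0

end EssentialBounds

/-! ### Value functions along a partition -/

section Values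

variable {d : ℕ} {U V : Type*} [MeasurableSpace U] [MeasurableSpace V] [Nonempty U] [Nonempty V]
  (f : ℝ → State d → U → V → State d) (g : State d → ℝ) {T : ℝ} (π : TimePartition T)

/-- The couple of controls associated with a couple of NAD-strategies over `[t,T]`. -/
noncomputable def outcome {π : TimePartition T} {t : Icc 0 T}
    (α : Strategy₁ π (t : ℝ) U V) (β : Strategy₂ π (t : ℝ) U V) :
    Control π privateField₁ U × Control π privateField₂ V :=
  (exists_outcome t.2.1 α β).choose

/-- The terminal pay-off `g(X_T^{t,x,α,β})`. -/
noncomputable def payoff {π : TimePartition T} (t : Icc 0 T) (x : State d)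
    (α : Strategy₁ π (t : ℝ) U V) (β : Strategy₂ π (t : ℝ) U V) (ω : Omega) : ℝ :=
  g (trajectory f T t x (fun r => (outcome α β).1.1 r ω) (fun r => (outcome α β).2.1 r ω) T)

/-- The conditional pay-off `E[g(X_T^{t,x,α,β}) | F_i]`, where `t_i ≤ t < t_{i+1}`
(and `i = n` if `t = T`). -/
noncomputable def condPayoff {π : TimePartition T} (t : Icc 0 T) (x : State d)
    (α : Strategy₁ π (t : ℝ) U V) (β : Strategy₂ π (t : ℝ) U V) : Omega →ₘ[P] ℝ :=
  AEEqFun.mk (condExp (pastField (π.index t)) P (payoff f g t x α β))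
    (stronglyMeasurable_condExp.mono (pastField_le _)).aestronglyMeasurable

/-- The lower value function along `π`, as a random field:
`esssup_α essinf_β E[g(X_T^{t,x,α,β}) | F_i]`. -/
noncomputable def randomLowerValue (t : Icc 0 T) (x : State d) : Omega →ₘ[P] ℝ :=
  essSupFamily fun α : Strategy₁ π (t : ℝ) U V =>
    essInfFamily fun β : Strategy₂ π (t : ℝ) U V => condPayoff f g t x α β

/-- The upper value function along `π`, as a random field:
`essinf_β esssup_α E[g(X_T^{t,x,α,β}) | F_i]`. -/
noncomputable def randomUpperValue (t : Icc 0 T) (x : State d) : Omega →ₘ[P] ℝ :=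
  essInfFamily fun β : Strategy₂ π (t : ℝ) U V =>
    essSupFamily fun α : Strategy₁ π (t : ℝ) U V => condPayoff f g t x α β

/-- The deterministic version of the lower value function along `π`, `E[V^π(t,x)]`. -/
noncomputable def lowerValue (t : Icc 0 T) (x : State d) : ℝ :=
  ∫ ω, randomLowerValue f g π t x ω ∂P

/-- The deterministic version of the upper value function along `π`, `E[U^π(t,x)]`. -/
noncomputable def upperValue (t : Icc 0 T) (x : State d) : ℝ :=
  ∫ ω, randomUpperValue f g π t x ω ∂P

end Values

end MixedGame

namespace MixedGame

/-! ### Partitions and the filtration -/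

/-! Two facts carry the proof: the values are almost surely constant, and constants belonging to
different initial times can be compared by transporting strategies.

Constancy (`value_ae_eq_const`). Adding a fixed θ modulo one to every coordinate of Ω preserves P,
each F_j and both families of private σ-fields. Conjugating strategies by such a rotation permutes
the strategies up to null sets and moves the conditional pay-off by the rotation, so the value is
invariant under every rotation. As Ω acts on itself transitively and commutatively, Fubini's theorem
forces an invariant random variable to equal its mean. This matters because for t and t' in
different partition intervals the values are conditioned on different σ-fields; for constants the
tower property removes the discrepancy.

Comparison (`abs_value_sub_le`). Let t ≤ t'. A strategy over [t',T] extends to [t,T] by a constant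
before t'; one over [t,T] restricts to [t',T] by pretending that the opponent played that constant
before t'. If one player's strategy is extended and the other's restricted, the two games produce
the same controls on [t',T] (`IsCouple.extend_restrict`). Along equal controls, Grönwall's
inequality bounds the gap of the pay-offs by Kg (|x - x'| + M (t' - t)) exp(Kf T). Near-optimal
strategies and answers convert this pathwise bound into one for the values. They exist because an
essential supremum is reached along a countable family, from which an F_i-measurable selector pastes
a single strategy; the pasting is legitimate because outcomes are local on events of F_i
(`IsCouple.agreeOnSet`).

The upper value is minus the lower value of the game with players exchanged and pay-off negated
(`value_swap_neg`), so only lower values need an argument. -/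

theorem TimePartition.node_mono {T : ℝ} (π : TimePartition T) {j k : ℕ} (hjk : j ≤ k)
    (hk : k ≤ π.n) : π.node j ≤ π.node k := by
  induction k, hjk using Nat.le_induction with
  | base => exact le_rfl
  | succ k _ ih => exact (ih (by omega)).trans (π.node_lt k (by omega)).le

theorem TimePartition.index_le {T : ℝ} (π : TimePartition T) (t : ℝ) : π.index t ≤ π.n := by
  classical
  exact Nat.findGreatest_le _

theorem TimePartition.node_index_le {T : ℝ} (π : TimePartition T) {t : ℝ} (ht : 0 ≤ t) :
    π.node (π.index t) ≤ t := by
  classical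
  exact Nat.findGreatest_spec (P := fun i => π.node i ≤ t) (Nat.zero_le π.n)
    (by rw [π.node_zero]; exact ht)

theorem TimePartition.index_mono {T : ℝ} (π : TimePartition T) {t t' : ℝ} (h : t ≤ t') :
    π.index t ≤ π.index t' := by
  classical
  exact Nat.findGreatest_mono_left (fun i hi => le_trans hi h) _

theorem pastField_mono {i j : ℕ} (h : i ≤ j) : pastField i ≤ pastField j :=
  biSup_mono fun _ hk => lt_of_lt_of_le hk h

/-! ### Admissible controls described by selectors -/

section Controls

variable {T : ℝ} {π : TimePartition T} {𝒦 : ℕ → MeasurableSpace Omega}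
  {A : Type*} [MeasurableSpace A]

/-- A countable F_j-measurable partition is the same datum as an F_j-measurable index with values in
ℕ. In this form, closure of the admissible controls under restarting, pasting and symmetries becomes
composition of measurable maps. -/
theorem IsAdmissible.exists_selector {u : ℝ → Omega → A} (h : IsAdmissible π 𝒦 u) {j : ℕ}
    (hj : j < π.n) : ∃ (κ : Omega → ℕ) (w : ℕ → ℝ → Omega → A),
      Measurable[pastField j] κ ∧
      (∀ k, Measurable (fun p : ℝ × Omega => w k p.1 p.2)) ∧
      (∀ k s, Measurable[𝒦 j] (w k s)) ∧
      ∀ s ∈ Ico (π.node j) (π.node (j + 1)), ∀ ω, u s ω = w (κ ω) s ω := by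
  obtain ⟨Γ, w, hΓ, hd, hU, hw, hw', hu⟩ := h.piecewise j hj
  have hex : ∀ ω, ∃ k, ω ∈ Γ k := fun ω => mem_iUnion.1 (hU ▸ mem_univ ω)
  choose κ hκ using hex
  have hpre : ∀ k, κ ⁻¹' {k} = Γ k := by
    intro k
    ext ω
    refine ⟨fun h => h ▸ hκ ω, fun h => ?_⟩
    by_contra hne
    exact Set.disjoint_left.1 (hd hne) (hκ ω) h
  refine ⟨κ, w, ?_, hw, hw', fun s hs ω => hu _ s hs ω (hκ ω)⟩
  refine @measurable_to_countable' ℕ Omega _ _ (pastField j) κ fun k => ?_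
  rw [hpre]
  exact hΓ k

theorem IsAdmissible.of_selector {u : ℝ → Omega → A}
    (hm : Measurable (fun p : ℝ × Omega => u p.1 p.2))
    (h : ∀ j < π.n, ∃ (κ : Omega → ℕ) (w : ℕ → ℝ → Omega → A),
      Measurable[pastField j] κ ∧
      (∀ k, Measurable (fun p : ℝ × Omega => w k p.1 p.2)) ∧
      (∀ k s, Measurable[𝒦 j] (w k s)) ∧
      ∀ s ∈ Ico (π.node j) (π.node (j + 1)), ∀ ω, u s ω = w (κ ω) s ω) :
    IsAdmissible π 𝒦 u where
  measurable := hm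
  piecewise j hj := by
    obtain ⟨κ, w, hκ, hw, hw', hu⟩ := h j hj
    refine ⟨fun k => κ ⁻¹' {k}, w, fun k => hκ (measurableSet_singleton k), ?_, ?_, hw, hw', ?_⟩
    · intro k l hkl
      exact Disjoint.preimage _ (by simpa using hkl)
    · exact eq_univ_of_forall fun ω => mem_iUnion.2 ⟨κ ω, rfl⟩
    · rintro k s hs ω rfl
      exact hu s hs ω

theorem measurable_ite_time {f g : ℝ × Omega → A} (r : ℝ) (hf : Measurable f)
    (hg : Measurable g) : Measurable (fun p : ℝ × Omega => if p.1 < r then f p else g p) :=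
  Measurable.ite (measurableSet_lt measurable_fst measurable_const) hf hg

/-- The control equal to `a` before time `r` and to `u` from `r` on. -/
noncomputable def Control.startAt (a : A) (r : ℝ) (u : Control π 𝒦 A) : Control π 𝒦 A :=
  ⟨fun s ω => if s < r then a else u.1 s ω, by
    refine IsAdmissible.of_selector (measurable_ite_time r measurable_const u.2.measurable) ?_
    intro j hj
    obtain ⟨κ, w, hκ, hw, hw', hu⟩ := u.2.exists_selector hj
    refine ⟨κ, fun k s ω => if s < r then a else w k s ω, hκ,
      fun k => measurable_ite_time r measurable_const (hw k), fun k s => ?_, fun s hs ω => ?_⟩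
    · by_cases h : s < r
      · simp only [h, if_true]; exact measurable_const
      · simp only [h, if_false]; exact hw' k s
    · simp only [hu s hs ω]⟩

theorem Control.startAt_apply (a : A) {r : ℝ} (u : Control π 𝒦 A) {s : ℝ} (h : r ≤ s)
    (ω : Omega) : (u.startAt a r).1 s ω = u.1 s ω := if_neg h.not_gt

/-- The control equal to `a` before time `t` and to `u (κ ω)` from `t` on. -/
noncomputable def Control.paste {t : ℝ} {i : ℕ} (hi : π.node i ≤ t) (hin : i ≤ π.n)
    (κ : Omega → ℕ) (hκ : Measurable[pastField i] κ) (a : A) (u : ℕ → Control π 𝒦 A) :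
    Control π 𝒦 A :=
  ⟨fun s ω => if s < t then a else (u (κ ω)).1 s ω, by
    have hκ' : Measurable κ := hκ.mono (pastField_le i) le_rfl
    refine IsAdmissible.of_selector (measurable_ite_time t measurable_const ?_) ?_
    · refine measurable_from_prod_countable_right (f := fun q : ℕ × (ℝ × Omega) =>
        (u q.1).1 q.2.1 q.2.2) (fun k => (u k).2.measurable) |>.comp
        ((hκ'.comp measurable_snd).prodMk measurable_id)
    intro j hj
    rcases lt_or_ge j i with hji | hij
    -- For j < i the whole interval lies before t_i ≤ t, where the constant is played; hence κ need
    -- not be known to F_j.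
    · refine ⟨fun _ => 0, fun _ _ _ => a, measurable_const, fun _ => measurable_const,
        fun _ _ => measurable_const, fun s hs ω => if_pos ?_⟩
      exact hs.2.trans_le ((π.node_mono hji hin).trans hi)
    · choose κ' w hκ' hw hw' hu using fun k => (u k).2.exists_selector hj
      -- The new index encodes both the selected control and the piece of that control; F_i ⊆ F_j
      -- makes both known at time t_j.
      refine ⟨fun ω => Nat.pair (κ ω) (κ' (κ ω) ω),
        fun k s ω => if s < t then a else w k.unpair.1 k.unpair.2 s ω, ?_, ?_, ?_, ?_⟩
      · have h1 : Measurable[pastField j] κ := hκ.mono (pastField_mono hij) le_rfl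
        have h2 : Measurable[pastField j] (fun ω => κ' (κ ω) ω) := by
          let _ := pastField j
          exact (measurable_from_prod_countable_right (f := fun q : ℕ × Omega => κ' q.1 q.2)
            (fun k => hκ' k)).comp (h1.prodMk measurable_id)
        let _ := pastField j
        exact (measurable_of_countable (fun q : ℕ × ℕ => Nat.pair q.1 q.2)).comp (h1.prodMk h2)
      · exact fun k => measurable_ite_time t measurable_const (hw _ _)
      · intro k s
        by_cases h : s < t
        · simp only [h, if_true]; exact measurable_const
        · simp only [h, if_false]; exact hw' _ _ s
      · intro s hs ω
        simp only [Nat.unpair_pair, hu (κ ω) s hs ω]⟩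

theorem Control.paste_apply {t : ℝ} {i : ℕ} (hi : π.node i ≤ t) (hin : i ≤ π.n)
    (κ : Omega → ℕ) (hκ : Measurable[pastField i] κ) (a : A) (u : ℕ → Control π 𝒦 A) {s : ℝ}
    (h : t ≤ s) (ω : Omega) : (Control.paste hi hin κ hκ a u).1 s ω = (u (κ ω)).1 s ω :=
  if_neg h.not_gt

theorem Control.measurable_path (u : Control π 𝒦 A) (ω : Omega) :
    Measurable (fun s => u.1 s ω) :=
  u.2.measurable.comp (measurable_id.prodMk measurable_const)

/-! ### Almost everywhere agreement on events -/

/-- `u = u'`, `ds dP`-a.e. on `[t,r] × S`. -/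
def AgreeOnSet (t r : ℝ) (S : Set Omega) (u u' : Control π 𝒦 A) : Prop :=
  ∀ᵐ p ∂((volume : Measure ℝ).prod P), t ≤ p.1 → p.1 ≤ r → p.2 ∈ S → u.1 p.1 p.2 = u'.1 p.1 p.2

theorem ae_time_ne (r : ℝ) : ∀ᵐ p ∂((volume : Measure ℝ).prod P), p.1 ≠ r :=
  Measure.quasiMeasurePreserving_fst.ae (measure_eq_zero_iff_ae_notMem.1 (measure_singleton r))

theorem AgreeOnSet.of_le {t r : ℝ} (h : r ≤ t) (S : Set Omega) (u u' : Control π 𝒦 A) :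
    AgreeOnSet t r S u u' := by
  filter_upwards [ae_time_ne t] with p hp h1 h2
  exact absurd (le_antisymm (h2.trans h) h1) hp

theorem AgreeOnSet.symm {t r : ℝ} {S : Set Omega} {u u' : Control π 𝒦 A}
    (h : AgreeOnSet t r S u u') : AgreeOnSet t r S u' u := by
  filter_upwards [h] with p hp h1 h2 h3
  exact (hp h1 h2 h3).symm

theorem AgreeOnSet.trans {t r : ℝ} {S : Set Omega} {u u' u'' : Control π 𝒦 A}
    (h : AgreeOnSet t r S u u') (h' : AgreeOnSet t r S u' u'') : AgreeOnSet t r S u u'' := by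
  filter_upwards [h, h'] with p hp hp' h1 h2 h3
  exact (hp h1 h2 h3).trans (hp' h1 h2 h3)

theorem AgreeOnSet.mono {t t' r r' : ℝ} {S S' : Set Omega} {u u' : Control π 𝒦 A}
    (h : AgreeOnSet t r S u u') (ht : t ≤ t') (hr : r' ≤ r) (hS : S' ⊆ S) :
    AgreeOnSet t' r' S' u u' := by
  filter_upwards [h] with p hp h1 h2 h3
  exact hp (ht.trans h1) (h2.trans hr) (hS h3)

theorem AgreeOn.agreeOnSet {t r : ℝ} {u u' : Control π 𝒦 A}
    (h : AgreeOn t (fun _ => r) u u') (S : Set Omega) : AgreeOnSet t r S u u' := by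
  filter_upwards [h] with p hp h1 h2 _
  exact hp h1 h2

theorem AgreeOnSet.agreeOn {t r : ℝ} {u u' : Control π 𝒦 A}
    (h : AgreeOnSet t r univ u u') : AgreeOn t (fun _ => r) u u' := by
  filter_upwards [h] with p hp h1 h2
  exact hp h1 h2 (mem_univ _)

theorem agreeOn_startAt (a : A) (t : ℝ) (r : Omega → ℝ) (u : Control π 𝒦 A) :
    AgreeOn t r (u.startAt a t) u :=
  ae_of_all _ fun p h1 _ => u.startAt_apply a h1 p.2

theorem AgreeOn.symm {t : ℝ} {r : Omega → ℝ} {u u' : Control π 𝒦 A}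
    (h : AgreeOn t r u u') : AgreeOn t r u' u := by
  filter_upwards [h] with p hp h1 h2
  exact (hp h1 h2).symm

theorem AgreeOn.trans {t : ℝ} {r : Omega → ℝ} {u u' u'' : Control π 𝒦 A}
    (h : AgreeOn t r u u') (h' : AgreeOn t r u' u'') : AgreeOn t r u u'' := by
  filter_upwards [h, h'] with p hp hp' h1 h2
  exact (hp h1 h2).trans (hp' h1 h2)

theorem AgreeOn.mono {t t' : ℝ} {r : Omega → ℝ} {u u' : Control π 𝒦 A}
    (h : AgreeOn t r u u') (ht : t ≤ t') : AgreeOn t' r u u' := by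
  filter_upwards [h] with p hp h1 h2
  exact hp (ht.trans h1) h2

/-- Controls which agree after `t'` agree after `t ≤ t'` once both are restarted at `t'`. -/
theorem AgreeOn.startAt {t t' : ℝ} {r : Omega → ℝ} {u u' : Control π 𝒦 A}
    (h : AgreeOn t' r u u') (a : A) : AgreeOn t r (u.startAt a t') (u'.startAt a t') := by
  filter_upwards [h] with p hp _ h2
  by_cases hs : p.1 < t'
  · simp only [Control.startAt, hs, if_true]
  · simp only [Control.startAt, hs, if_false]
    exact hp (not_lt.1 hs) h2

/-- Fubini's theorem turns agreement ds dP-a.e. into agreement of almost every path, the form in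
which a pathwise pay-off can use it. -/
theorem AgreeOnSet.ae_path {t r : ℝ} {S : Set Omega} {u u' : Control π 𝒦 A}
    (h : AgreeOnSet t r S u u') :
    ∀ᵐ ω ∂P, ω ∈ S → ∀ᵐ s : ℝ, t ≤ s → s ≤ r → u.1 s ω = u'.1 s ω := by
  have h' : ∀ᵐ q ∂(P.prod (volume : Measure ℝ)),
      t ≤ q.2 → q.2 ≤ r → q.1 ∈ S → u.1 q.2 q.1 = u'.1 q.2 q.1 :=
    (Measure.measurePreserving_swap (μ := P) (ν := (volume : Measure ℝ))).quasiMeasurePreserving.ae h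
  filter_upwards [Measure.ae_ae_of_ae_prod h'] with ω hω hS
  filter_upwards [hω] with s hs h1 h2
  exact hs h1 h2 hS

end Controls

/-! ### Operations on strategies -/

section Strategies

variable {T : ℝ} {π : TimePartition T} {t t' : ℝ}
  {𝒦 𝒦' : ℕ → MeasurableSpace Omega} {A B : Type*} [MeasurableSpace A] [MeasurableSpace B]

instance [Nonempty B] : Nonempty (NADStrategy π t 𝒦 A 𝒦' B) :=
  ⟨⟨fun _ => ⟨_, isAdmissible_const π 𝒦' (Classical.arbitrary B)⟩,
    fun _ _ _ _ _ => ae_of_all _ fun _ _ _ => rfl⟩⟩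

/-- A strategy over `[t',T]` seen as a strategy over `[t,T]`, `t ≤ t'`: it plays `b` before `t'`. -/
noncomputable def NADStrategy.extend (h : t ≤ t') (b : B) (β : NADStrategy π t' 𝒦 A 𝒦' B) :
    NADStrategy π t 𝒦 A 𝒦' B where
  toFun u := (β.toFun u).startAt b t'
  nonanticipative τ hτ _ _ huu := (β.nonanticipative τ hτ _ _ (huu.mono h)).startAt b

/-- A strategy over `[t,T]` seen as a strategy over `[t',T]`, `t ≤ t'`: it pretends that the
opponent has played `a` before `t'`. -/
noncomputable def NADStrategy.restrict (h : t ≤ t') (a : A) (β : NADStrategy π t 𝒦 A 𝒦' B) :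
    NADStrategy π t' 𝒦 A 𝒦' B where
  toFun u := β.toFun (u.startAt a t')
  nonanticipative τ hτ _ _ huu :=
    (β.nonanticipative τ hτ _ _ (huu.startAt a)).mono h

/-- The strategy which plays `β (κ ω)`, the selector `κ` being known at the initial time. -/
noncomputable def NADStrategy.paste {i : ℕ} (hi : π.node i ≤ t) (hin : i ≤ π.n)
    (κ : Omega → ℕ) (hκ : Measurable[pastField i] κ) (b : B)
    (β : ℕ → NADStrategy π t 𝒦 A 𝒦' B) : NADStrategy π t 𝒦 A 𝒦' B where
  toFun u := Control.paste hi hin κ hκ b fun k => (β k).toFun u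
  nonanticipative τ hτ u u' huu := by
    have := ae_all_iff.2 fun k => (β k).nonanticipative τ hτ u u' huu
    filter_upwards [this] with p hp h1 h2
    simp only [Control.paste_apply hi hin κ hκ b _ h1]
    exact hp _ h1 h2

theorem NADStrategy.paste_agreeOnSet {i : ℕ} (hi : π.node i ≤ t) (hin : i ≤ π.n)
    (κ : Omega → ℕ) (hκ : Measurable[pastField i] κ) (b : B)
    (β : ℕ → NADStrategy π t 𝒦 A 𝒦' B) (k : ℕ) (u : Control π 𝒦 A) :
    AgreeOnSet t T (κ ⁻¹' {k}) ((NADStrategy.paste hi hin κ hκ b β).toFun u)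
      ((β k).toFun u) := by
  refine ae_of_all _ fun p h1 _ h3 => ?_
  have h3 : κ p.2 = k := h3
  simp only [NADStrategy.paste, Control.paste_apply hi hin κ hκ b _ h1, h3]

/-- The stopping time equal to j on S and to i off S localizes nonanticipativity: it is a stopping
time since S belongs to F_i and i ≤ j, and off S nothing has to be checked because t_i ≤ t leaves a
null set of times. -/
theorem NADStrategy.local_step (β : NADStrategy π t 𝒦 A 𝒦' B) {i j : ℕ} (hi : π.node i ≤ t)
    (hij : i ≤ j) (hj : j < π.n) {S : Set Omega} (hS : MeasurableSet[pastField i] S)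
    {u u' : Control π 𝒦 A} (h : AgreeOnSet t (π.node j) S u u') :
    AgreeOnSet t (π.node (j + 1)) S (β.toFun u) (β.toFun u') := by
  classical
  let τ : Omega → ℕ := fun ω => if ω ∈ S then j else i
  have hτ : IsStopping π τ := by
    refine ⟨fun ω => ?_, fun k => ?_⟩
    · by_cases hω : ω ∈ S
      · simpa [τ, hω] using hj
      · simpa [τ, hω] using hij.trans_lt hj
    · have : {ω | τ ω = k} = (S ∩ {_ω | j = k}) ∪ (Sᶜ ∩ {_ω | i = k}) := by
        ext ω
        by_cases hω : ω ∈ S <;> simp [τ, hω]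
      rw [this]
      by_cases hk : i ≤ k
      · have hS' : MeasurableSet[pastField k] S := pastField_mono hk _ hS
        exact (hS'.inter (MeasurableSet.const _)).union (hS'.compl.inter (MeasurableSet.const _))
      · have h1 : j ≠ k := by omega
        have h2 : i ≠ k := by omega
        simp [h1, h2]
  have h0 : AgreeOn t (fun ω => π.node (τ ω)) u u' := by
    filter_upwards [h, ae_time_ne t] with p hp hne h1 h2
    by_cases hω : p.2 ∈ S
    · simp only [τ, hω, if_true] at h2
      exact hp h1 h2 hω
    · simp only [τ, hω, if_false] at h2
      exact absurd (le_antisymm (h2.trans hi) h1) hne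
  filter_upwards [β.nonanticipative τ hτ u u' h0] with p hp h1 h2 h3
  refine hp h1 ?_
  simpa [τ, h3] using h2

/-- The couple `(u,v)` of controls satisfies `α(v) = u`, `β(u) = v`, `ds dP`-a.e. -/
def IsCouple (α : NADStrategy π t 𝒦' B 𝒦 A) (β : NADStrategy π t 𝒦 A 𝒦' B)
    (u : Control π 𝒦 A) (v : Control π 𝒦' B) : Prop :=
  AgreeOn t (fun _ => T) (α.toFun v) u ∧ AgreeOn t (fun _ => T) (β.toFun u) v

theorem IsCouple.swap {α : NADStrategy π t 𝒦' B 𝒦 A} {β : NADStrategy π t 𝒦 A 𝒦' B}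
    {u : Control π 𝒦 A} {v : Control π 𝒦' B} (h : IsCouple α β u v) : IsCouple β α v u :=
  ⟨h.2, h.1⟩

/-- Strategies which coincide on an event known at the initial time have the same couples of
controls on this event. -/
theorem IsCouple.agreeOnSet {i : ℕ} (hi : π.node i ≤ t) (hin : i ≤ π.n) {S : Set Omega}
    (hS : MeasurableSet[pastField i] S) {α α' : NADStrategy π t 𝒦' B 𝒦 A}
    {β β' : NADStrategy π t 𝒦 A 𝒦' B} {u u' : Control π 𝒦 A} {v v' : Control π 𝒦' B}
    (hα : ∀ v, AgreeOnSet t T S (α.toFun v) (α'.toFun v))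
    (hβ : ∀ u, AgreeOnSet t T S (β.toFun u) (β'.toFun u))
    (h : IsCouple α β u v) (h' : IsCouple α' β' u' v') :
    AgreeOnSet t T S u u' ∧ AgreeOnSet t T S v v' := by
  have key : ∀ j, i ≤ j → j ≤ π.n →
      AgreeOnSet t (π.node j) S u u' ∧ AgreeOnSet t (π.node j) S v v' := by
    intro j hij
    induction j, hij using Nat.le_induction with
    | base => exact fun _ => ⟨.of_le hi _ _ _, .of_le hi _ _ _⟩
    | succ j hij ih =>
      intro hj
      obtain ⟨h1, h2⟩ := ih (by omega)
      have hT : π.node (j + 1) ≤ T := (π.node_mono hj le_rfl).trans_eq π.node_last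
      constructor
      -- On S the chain is u = α(v) = α(v') = α'(v') = u'; the delay in the second equality gains
      -- one partition interval.
      · exact ((h.1.agreeOnSet S).symm.mono le_rfl hT le_rfl).trans
          ((α.local_step hi hij hj hS h2).trans
            (((hα v').trans (h'.1.agreeOnSet S)).mono le_rfl hT le_rfl))
      · exact ((h.2.agreeOnSet S).symm.mono le_rfl hT le_rfl).trans
          ((β.local_step hi hij hj hS h1).trans
            (((hβ u').trans (h'.2.agreeOnSet S)).mono le_rfl hT le_rfl))
  have := key π.n hin le_rfl
  rwa [π.node_last] at this

/-- Stopping times stay below n, so agreement up to T comes from the node n - 1 and the one-step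
delay. If i = n, then t ≥ T and the time interval is null. -/
theorem NADStrategy.congr (β : NADStrategy π t 𝒦 A 𝒦' B) {i : ℕ} (hi : π.node i ≤ t)
    (hin : i ≤ π.n) {u u' : Control π 𝒦 A} (h : AgreeOn t (fun _ => T) u u') :
    AgreeOn t (fun _ => T) (β.toFun u) (β.toFun u') := by
  refine AgreeOnSet.agreeOn ?_
  rcases hin.eq_or_lt with rfl | hlt
  · exact .of_le (π.node_last ▸ hi) _ _ _
  · have hn : π.n - 1 + 1 = π.n := by omega
    have := β.local_step (j := π.n - 1) hi (by omega) (by omega) MeasurableSet.univ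
      ((h.agreeOnSet univ).mono le_rfl ((π.node_mono (Nat.sub_le _ _) le_rfl).trans_eq
        π.node_last) le_rfl)
    rwa [hn, π.node_last] at this

/-- The couple of controls of `α'.extend` and `β` continues that of `α'` and `β.restrict`. -/
theorem IsCouple.extend_restrict (h : t ≤ t') {i : ℕ} (hi : π.node i ≤ t') (hin : i ≤ π.n)
    (a : A) {α' : NADStrategy π t' 𝒦' B 𝒦 A}
    {β : NADStrategy π t 𝒦 A 𝒦' B} {u : Control π 𝒦 A} {v : Control π 𝒦' B}
    (hc : IsCouple α' (β.restrict h a) u v) :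
    IsCouple (α'.extend h a) β (u.startAt a t') (β.toFun (u.startAt a t')) :=
  -- By definition of the restriction, `hc.2` says that β answers the restarted u by v after t';
  -- hence α' replies to that answer with u.
  ⟨((α'.congr hi hin hc.2).trans hc.1).startAt a, ae_of_all _ fun _ _ _ => rfl⟩

end Strategies

/-! ### Symmetries of the randomization space -/

/-- A measure preserving map of `Ω` which respects the filtration and the private σ-fields. -/
structure IsSymmetry (𝒦 : ℕ → MeasurableSpace Omega) (σ : Omega → Omega) : Prop where
  preserving : MeasurePreserving σ P P
  past : ∀ j, Measurable[pastField j, pastField j] σ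
  priv : ∀ j, Measurable[𝒦 j, 𝒦 j] σ

section Symmetries

variable {T : ℝ} {π : TimePartition T} {t : ℝ}
  {𝒦 𝒦' : ℕ → MeasurableSpace Omega} {A B : Type*} [MeasurableSpace A] [MeasurableSpace B]
  {σ σ' : Omega → Omega}

/-- The control `u ∘ σ`. -/
def Control.comp (u : Control π 𝒦 A) (hσ : IsSymmetry 𝒦 σ) : Control π 𝒦 A :=
  ⟨fun s ω => u.1 s (σ ω), by
    refine IsAdmissible.of_selector
      (u.2.measurable.comp (measurable_fst.prodMk (hσ.preserving.measurable.comp measurable_snd)))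
      fun j hj => ?_
    obtain ⟨κ, w, hκ, hw, hw', hu⟩ := u.2.exists_selector hj
    exact ⟨κ ∘ σ, fun k s => w k s ∘ σ, hκ.comp (hσ.past j),
      fun k => (hw k).comp
        (measurable_fst.prodMk (hσ.preserving.measurable.comp measurable_snd)),
      fun k s => (hw' k s).comp (hσ.priv j), fun s hs ω => hu s hs (σ ω)⟩⟩

theorem IsStopping.comp {τ : Omega → ℕ} (hτ : IsStopping π τ) (hσ : IsSymmetry 𝒦 σ) :
    IsStopping π (τ ∘ σ) :=
  ⟨fun ω => hτ.lt (σ ω), fun j => hσ.past j (hτ.meas j)⟩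

theorem AgreeOn.comp {r : Omega → ℝ} {u u' : Control π 𝒦 A} (h : AgreeOn t r u u')
    (hσ : IsSymmetry 𝒦 σ) : AgreeOn t (r ∘ σ) (u.comp hσ) (u'.comp hσ) :=
  ((MeasurePreserving.id (volume : Measure ℝ)).prod hσ.preserving).quasiMeasurePreserving.ae h

theorem agreeOn_comp_comp (hσ : IsSymmetry 𝒦 σ) (hσ' : IsSymmetry 𝒦 σ')
    (hinv : ∀ᵐ ω ∂P, σ' (σ ω) = ω) (r : Omega → ℝ) (u : Control π 𝒦 A) :
    AgreeOn t r ((u.comp hσ').comp hσ) u := by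
  have := (Measure.quasiMeasurePreserving_snd (μ := (volume : Measure ℝ)) (ν := P)).ae hinv
  filter_upwards [this] with p hp _ _
  simp only [Control.comp, hp]

/-- The strategy `u ↦ β(u ∘ σ') ∘ σ`, for mutually inverse symmetries `σ`, `σ'`. -/
def NADStrategy.conj (β : NADStrategy π t 𝒦 A 𝒦' B) (hσ' : IsSymmetry 𝒦 σ')
    (hσ : IsSymmetry 𝒦' σ) (hinv : ∀ᵐ ω ∂P, σ' (σ ω) = ω) : NADStrategy π t 𝒦 A 𝒦' B where
  toFun u := (β.toFun (u.comp hσ')).comp hσ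
  nonanticipative τ hτ u u' huu := by
    -- The stopping time τ ∘ σ' is used for the conjugated controls; composing with σ returns τ
    -- almost surely.
    have h := (β.nonanticipative _ (hτ.comp hσ') _ _ (huu.comp hσ')).comp hσ
    have h' := (Measure.quasiMeasurePreserving_snd (μ := (volume : Measure ℝ)) (ν := P)).ae hinv
    filter_upwards [h, h'] with p hp hp' h1 h2
    refine hp h1 ?_
    simpa only [Function.comp_apply, hp'] using h2

/-- Conjugating the strategies moves the couple of controls. -/
theorem IsCouple.conj {α : NADStrategy π t 𝒦' B 𝒦 A} {β : NADStrategy π t 𝒦 A 𝒦' B}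
    {i : ℕ} (hi : π.node i ≤ t) (hin : i ≤ π.n)
    (h₁ : IsSymmetry 𝒦 σ) (h₂ : IsSymmetry 𝒦' σ) (h₂' : IsSymmetry 𝒦' σ')
    (hinv : ∀ᵐ ω ∂P, σ' (σ ω) = ω) (hinv' : ∀ᵐ ω ∂P, σ (σ' ω) = ω)
    {u : Control π 𝒦 A} {v : Control π 𝒦' B}
    (h : IsCouple α (β.conj h₁ h₂' hinv') u v) :
    IsCouple (α.conj h₂' h₁ hinv) β (u.comp h₁) (v.comp h₂) := by
  constructor
  · exact ((α.congr hi hin (agreeOn_comp_comp h₂' h₂ hinv' _ v)).trans h.1).comp h₁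
  · exact (agreeOn_comp_comp h₂ h₂' hinv _ _).symm.trans (h.2.comp h₂)

/-- Every s in F_i is, up to a null set, the σ-preimage of σ'⁻¹(s), again an event of F_i.
Invariance of P then turns the defining integrals over s into integrals over σ'⁻¹(s). -/
theorem condExp_comp_symmetry (i : ℕ) (h₁ : IsSymmetry 𝒦 σ) (h₂ : IsSymmetry 𝒦' σ')
    (hinv : ∀ᵐ ω ∂P, σ' (σ ω) = ω) {h : Omega → ℝ} (hh : Integrable h P) :
    (fun ω => (P[h|pastField i]) (σ ω)) =ᵐ[P] P[fun ω => h (σ ω)|pastField i] := by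
  have hσ := h₁.preserving
  have hm := pastField_le i
  refine ae_eq_condExp_of_forall_setIntegral_eq hm (hσ.integrable_comp_of_integrable hh) ?_ ?_ ?_
  · intro s _ _
    exact (hσ.integrable_comp_of_integrable integrable_condExp).integrableOn
  · intro s hs _
    have hs' : MeasurableSet[pastField i] (σ' ⁻¹' s) := h₂.past i hs
    have hae : s =ᵐ[P] σ ⁻¹' (σ' ⁻¹' s) := by
      filter_upwards [hinv] with ω hω
      change (ω ∈ s) = (σ' (σ ω) ∈ s)
      rw [hω]
    have key : ∀ k : Omega → ℝ, Integrable k P →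
        ∫ ω in s, k (σ ω) ∂P = ∫ ω in σ' ⁻¹' s, k ω ∂P := by
      intro k hk
      rw [setIntegral_congr_set hae, ← integral_indicator (hσ.measurable (hm _ hs')),
        ← integral_indicator (hm _ hs')]
      have h1 : AEStronglyMeasurable ((σ' ⁻¹' s).indicator k) (P.map σ) := by
        rw [hσ.map_eq]
        exact (hk.indicator (hm _ hs')).aestronglyMeasurable
      conv_rhs => rw [← hσ.map_eq]
      rw [integral_map hσ.aemeasurable h1]
      rfl
    rw [key _ integrable_condExp, key _ hh, setIntegral_condExp hm hh hs']
  · exact (stronglyMeasurable_condExp.comp_measurable (h₁.past i)).aestronglyMeasurable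

end Symmetries

/-! ### Rotations -/

/-- Addition modulo one on the unit interval. -/
noncomputable def rotate (θ x : unitInterval) : unitInterval :=
  ⟨Int.fract ((θ : ℝ) + x), Int.fract_nonneg _, (Int.fract_lt_one _).le⟩

theorem measurable_rotate : Measurable (fun p : unitInterval × unitInterval => rotate p.1 p.2) := by
  refine Measurable.subtype_mk (measurable_fract.comp ?_)
  fun_prop

theorem rotate_comm (θ x : unitInterval) : rotate θ x = rotate x θ := by
  simp only [rotate, add_comm]

theorem measurePreserving_toCircle :
    MeasurePreserving (fun x : unitInterval => ((x : ℝ) : UnitAddCircle)) volume volume := by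
  have h := UnitAddCircle.measurePreserving_mk 0
  rw [zero_add, Measure.restrict_congr_set Ioc_ae_eq_Icc] at h
  exact h.comp unitInterval.measurePreserving_coe

/-- The representative in `[0,1)` of an element of the circle. -/
noncomputable def ofCircle (c : UnitAddCircle) : unitInterval :=
  ⟨AddCircle.equivIco 1 0 c, (AddCircle.equivIco 1 0 c).2.1,
    (AddCircle.equivIco 1 0 c).2.2.le.trans_eq (zero_add 1)⟩

theorem ofCircle_coe (y : ℝ) : (ofCircle (y : UnitAddCircle) : ℝ) = Int.fract y := by
  simp [ofCircle, AddCircle.coe_equivIco_mk_apply]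

theorem measurable_ofCircle : Measurable ofCircle :=
  (measurable_subtype_coe.comp (AddCircle.measurableEquivIco 1 0).measurable).subtype_mk

theorem measurePreserving_ofCircle : MeasurePreserving ofCircle volume volume := by
  refine ⟨measurable_ofCircle, ?_⟩
  have hφ := measurePreserving_toCircle
  rw [← hφ.map_eq, Measure.map_map measurable_ofCircle hφ.measurable]
  refine (Measure.map_congr (g := id) ?_).trans Measure.map_id
  have h1 : ∀ᵐ x : unitInterval, x ≠ 1 := measure_eq_zero_iff_ae_notMem.1 (measure_singleton 1)
  filter_upwards [h1] with x hx
  have hx1 : (x : ℝ) < 1 := lt_of_le_of_ne x.2.2 fun h => hx (Subtype.ext h)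
  apply Subtype.ext
  simp only [Function.comp_apply, ofCircle_coe, id]
  exact Int.fract_eq_self.2 ⟨x.2.1, hx1⟩

/-- The rotation factors through the circle, where it is a translation and Haar measure is
invariant. -/
theorem measurePreserving_rotate (θ : unitInterval) :
    MeasurePreserving (rotate θ) volume volume := by
  have hφ := measurePreserving_toCircle
  have h := (measurePreserving_ofCircle.comp
    (measurePreserving_add_left volume ((θ : ℝ) : UnitAddCircle))).comp hφ
  convert h using 1
  funext x
  apply Subtype.ext
  simp only [Function.comp_apply]
  rw [← AddCircle.coe_add, ofCircle_coe]
  rfl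

/-- Modulo one, 1 - θ is the inverse of θ. The identity fails at x = 1, which is identified with 0;
therefore symmetries are inverted only almost surely throughout. -/
theorem rotate_symm_rotate (θ : unitInterval) :
    ∀ᵐ x : unitInterval, rotate (unitInterval.symm θ) (rotate θ x) = x := by
  have h1 : ∀ᵐ x : unitInterval, x ≠ 1 := measure_eq_zero_iff_ae_notMem.1 (measure_singleton 1)
  filter_upwards [h1] with x hx
  have hx1 : (x : ℝ) < 1 := lt_of_le_of_ne x.2.2 fun h => hx (Subtype.ext h)
  apply Subtype.ext
  simp only [rotate, unitInterval.coe_symm_eq]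
  rw [Int.fract_eq_iff]
  refine ⟨x.2.1, hx1, 1 - ⌊(θ : ℝ) + x⌋, ?_⟩
  rw [Int.fract]
  push_cast
  ring

/-- The rotation of `Ω` by `θ`, coordinate by coordinate. -/
noncomputable def rotation (θ ω : Omega) : Omega :=
  fun j => (rotate (θ j).1 (ω j).1, rotate (θ j).2 (ω j).2)

noncomputable def negRotation (θ : Omega) : Omega :=
  fun j => (unitInterval.symm (θ j).1, unitInterval.symm (θ j).2)

theorem measurable_rotation : Measurable (fun p : Omega × Omega => rotation p.1 p.2) := by
  refine measurable_pi_lambda _ fun j => ?_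
  exact (measurable_rotate.comp (f := fun p : Omega × Omega => ((p.1 j).1, (p.2 j).1))
    (by fun_prop)).prodMk (measurable_rotate.comp
      (f := fun p : Omega × Omega => ((p.1 j).2, (p.2 j).2)) (by fun_prop))

theorem measurable_rotation_left (θ : Omega) : Measurable (rotation θ) :=
  measurable_rotation.comp (measurable_const.prodMk measurable_id)

theorem measurePreserving_rotation (θ : Omega) : MeasurePreserving (rotation θ) P P := by
  refine ⟨measurable_rotation_left θ, ?_⟩
  have h := fun j => (measurePreserving_rotate (θ j).1).prod (measurePreserving_rotate (θ j).2)
  have := Measure.infinitePi_map_pi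
    (μ := fun _ : ℕ => (volume : Measure (unitInterval × unitInterval)))
    (f := fun j => Prod.map (rotate (θ j).1) (rotate (θ j).2)) (fun j => (h j).measurable)
  refine this.trans ?_
  congr 1
  funext j
  exact (h j).map_eq

theorem rotation_comm (θ ω : Omega) : rotation θ ω = rotation ω θ := by
  funext j
  simp only [rotation, rotate_comm]

theorem negRotation_rotation (θ : Omega) :
    ∀ᵐ ω ∂P, rotation (negRotation θ) (rotation θ ω) = ω := by
  have h : ∀ j : ℕ, ∀ᵐ ω ∂P, rotation (negRotation θ) (rotation θ ω) j = ω j := by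
    intro j
    have h1 : ∀ᵐ y : unitInterval × unitInterval,
        rotate (unitInterval.symm (θ j).1) (rotate (θ j).1 y.1) = y.1 :=
      Measure.quasiMeasurePreserving_fst.ae (rotate_symm_rotate _)
    have h2 : ∀ᵐ y : unitInterval × unitInterval,
        rotate (unitInterval.symm (θ j).2) (rotate (θ j).2 y.2) = y.2 :=
      Measure.quasiMeasurePreserving_snd.ae (rotate_symm_rotate _)
    have := (measurePreserving_eval_infinitePi
      (fun _ : ℕ => (volume : Measure (unitInterval × unitInterval))) j).quasiMeasurePreserving.ae
      (h1.and h2)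
    filter_upwards [this] with ω hω
    exact Prod.ext hω.1 hω.2
  filter_upwards [ae_all_iff.2 h] with ω hω
  exact funext hω

theorem negRotation_negRotation (θ : Omega) : negRotation (negRotation θ) = θ := by
  funext j
  simp [negRotation]

theorem measurable_pastField_rotation (θ : Omega) (j : ℕ) :
    Measurable[pastField j, pastField j] (rotation θ) := by
  rw [measurable_iff_comap_le, pastField, MeasurableSpace.comap_iSup]
  refine iSup_le fun i => ?_
  rw [MeasurableSpace.comap_iSup]
  refine iSup_le fun hi => ?_
  rw [MeasurableSpace.comap_comp]
  refine le_trans ?_ (le_iSup₂ (f := fun i (_ : i ∈ Iio j) =>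
    MeasurableSpace.comap (fun ω : Omega => ω i) inferInstance) i hi)
  have : (fun ω : Omega => ω i) ∘ rotation θ =
      Prod.map (rotate (θ i).1) (rotate (θ i).2) ∘ fun ω : Omega => ω i := rfl
  rw [this, ← MeasurableSpace.comap_comp]
  exact MeasurableSpace.comap_mono
    ((measurePreserving_rotate _).measurable.prodMap
      (measurePreserving_rotate _).measurable).comap_le

theorem isSymmetry_rotation₁ (θ : Omega) : IsSymmetry privateField₁ (rotation θ) where
  preserving := measurePreserving_rotation θ
  past := measurable_pastField_rotation θ
  priv j := by
    rw [measurable_iff_comap_le, privateField₁, MeasurableSpace.comap_comp]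
    have : (fun ω : Omega => (ω j).1) ∘ rotation θ = rotate (θ j).1 ∘ fun ω => (ω j).1 := rfl
    rw [this, ← MeasurableSpace.comap_comp]
    exact MeasurableSpace.comap_mono (measurePreserving_rotate _).measurable.comap_le

theorem isSymmetry_rotation₂ (θ : Omega) : IsSymmetry privateField₂ (rotation θ) where
  preserving := measurePreserving_rotation θ
  past := measurable_pastField_rotation θ
  priv j := by
    rw [measurable_iff_comap_le, privateField₂, MeasurableSpace.comap_comp]
    have : (fun ω : Omega => (ω j).2) ∘ rotation θ = rotate (θ j).2 ∘ fun ω => (ω j).2 := rfl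
    rw [this, ← MeasurableSpace.comap_comp]
    exact MeasurableSpace.comap_mono (measurePreserving_rotate _).measurable.comap_le

/-- A function which is invariant under all rotations is constant. -/
theorem ae_eq_const_of_rotation_invariant {Y : Omega → ℝ} (hY : Measurable Y)
    (h : ∀ θ, ∀ᵐ ω ∂P, Y (rotation θ ω) = Y ω) : ∀ᵐ ω ∂P, Y ω = ∫ ω', Y ω' ∂P := by
  have hs : MeasurableSet {p : Omega × Omega | Y (rotation p.1 p.2) = Y p.2} :=
    measurableSet_eq_fun (hY.comp measurable_rotation) (hY.comp measurable_snd)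
  -- The exceptional null set depends on θ. Fubini's theorem exchanges the quantifiers: for almost
  -- every ω the identity holds for almost every θ, and then integration in θ, with the roles of θ
  -- and ω exchanged by commutativity, gives the mean of Y.
  have h1 : ∀ᵐ p ∂(P.prod P), Y (rotation p.1 p.2) = Y p.2 :=
    (Measure.ae_prod_iff_ae_ae hs).2 (ae_of_all _ h)
  have h2 : ∀ᵐ q ∂(P.prod P), Y (rotation q.2 q.1) = Y q.1 :=
    (Measure.measurePreserving_swap (μ := P) (ν := P)).quasiMeasurePreserving.ae h1
  filter_upwards [Measure.ae_ae_of_ae_prod h2] with ω hω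
  have h3 : ∫ θ, Y (rotation ω θ) ∂P = ∫ θ, Y θ ∂P := by
    conv_rhs => rw [← (measurePreserving_rotation ω).map_eq]
    rw [integral_map (measurable_rotation_left ω).aemeasurable hY.aestronglyMeasurable]
  have h4 : ∫ θ, Y (rotation ω θ) ∂P = ∫ _θ : Omega, Y ω ∂P := by
    refine integral_congr_ae ?_
    filter_upwards [hω] with θ hθ
    rw [rotation_comm, hθ]
  rw [← h3, h4]
  simp

/-! ### Essential suprema of bounded families -/

section EssentialBounds

variable {ι : Type*}

theorem le_of_ae_le {X Y : Omega →ₘ[P] ℝ} (h : ∀ᵐ ω ∂P, X ω ≤ Y ω) : X ≤ Y :=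
  AEEqFun.coeFn_le.1 h

theorem ae_le_of_le {X Y : Omega →ₘ[P] ℝ} (h : X ≤ Y) : ∀ᵐ ω ∂P, X ω ≤ Y ω :=
  AEEqFun.coeFn_le.2 h

theorem aeEqFun_neg_le_neg {X Y : Omega →ₘ[P] ℝ} (h : X ≤ Y) : -Y ≤ -X := by
  refine le_of_ae_le ?_
  filter_upwards [ae_le_of_le h, AEEqFun.coeFn_neg X, AEEqFun.coeFn_neg Y] with ω h1 h2 h3
  rw [h2, h3]
  exact neg_le_neg h1

theorem isGLB_neg_range {F : ι → Omega →ₘ[P] ℝ} {Y : Omega →ₘ[P] ℝ} (h : IsLUB (range F) Y) :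
    IsGLB (range fun i => -F i) (-Y) := by
  constructor
  · rintro _ ⟨i, rfl⟩
    exact aeEqFun_neg_le_neg (h.1 ⟨i, rfl⟩)
  · intro Z hZ
    have : Y ≤ -Z := h.2 <| by
      rintro _ ⟨i, rfl⟩
      simpa using aeEqFun_neg_le_neg (hZ ⟨i, rfl⟩)
    simpa using aeEqFun_neg_le_neg this

theorem isLUB_neg_range {F : ι → Omega →ₘ[P] ℝ} {Y : Omega →ₘ[P] ℝ} (h : IsGLB (range F) Y) :
    IsLUB (range fun i => -F i) (-Y) := by
  constructor
  · rintro _ ⟨i, rfl⟩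
    exact aeEqFun_neg_le_neg (h.1 ⟨i, rfl⟩)
  · intro Z hZ
    have : -Z ≤ Y := h.2 <| by
      rintro _ ⟨i, rfl⟩
      simpa using aeEqFun_neg_le_neg (hZ ⟨i, rfl⟩)
    simpa using aeEqFun_neg_le_neg this

/-- A bounded family has a least upper bound for the almost sure order, and it is the pointwise
supremum of a countable subfamily. -/
theorem exists_isLUB_seq [Nonempty ι] (F : ι → Omega →ₘ[P] ℝ) {C : ℝ}
    (hC : ∀ i, ∀ᵐ ω ∂P, |F i ω| ≤ C) :
    ∃ (Y : Omega →ₘ[P] ℝ) (s : ℕ → ι), IsLUB (range F) Y ∧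
      ∀ᵐ ω ∂P, IsLUB (range fun k => F (s k) ω) (Y ω) := by
  let G : (ℕ → ι) → Omega → ℝ := fun s ω => ⨆ k, F (s k) ω
  have hGm : ∀ s, Measurable (G s) := fun s => Measurable.iSup fun k => (F (s k)).measurable
  have hlub : ∀ s, ∀ᵐ ω ∂P, IsLUB (range fun k => F (s k) ω) (G s ω) := by
    intro s
    filter_upwards [ae_all_iff.2 fun k => hC (s k)] with ω hω
    exact isLUB_ciSup ⟨C, by rintro _ ⟨k, rfl⟩; exact (abs_le.1 (hω k)).2⟩
  have hGb : ∀ s, ∀ᵐ ω ∂P, |G s ω| ≤ C := by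
    intro s
    filter_upwards [ae_all_iff.2 fun k => hC (s k), hlub s] with ω hω hl
    refine abs_le.2 ⟨(abs_le.1 (hω 0)).1.trans (hl.1 ⟨0, rfl⟩), hl.2 ?_⟩
    rintro _ ⟨k, rfl⟩
    exact (abs_le.1 (hω k)).2
  have hGi : ∀ s, Integrable (G s) P := fun s =>
    Integrable.of_bound (hGm s).aestronglyMeasurable C (by simpa using hGb s)
  have hbdd : BddAbove (range fun s => ∫ ω, G s ω ∂P) := by
    refine ⟨C, ?_⟩
    rintro _ ⟨s, rfl⟩
    refine (integral_mono_ae (hGi s) (integrable_const C) ?_).trans_eq (by simp)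
    filter_upwards [hGb s] with ω hω using (abs_le.1 hω).2
  have hex : ∀ n : ℕ, ∃ s, (⨆ s, ∫ ω, G s ω ∂P) - 1 / ((n : ℝ) + 1) < ∫ ω, G s ω ∂P :=
    fun n => exists_lt_of_lt_ciSup (sub_lt_self _ Nat.one_div_pos_of_nat)
  choose S hS using hex
  -- Merging maximizing sequences into one attains the supremum of the integrals of countable
  -- suprema.
  let s : ℕ → ι := fun m => S m.unpair.1 m.unpair.2
  have hle : ∀ n, ∫ ω, G (S n) ω ∂P ≤ ∫ ω, G s ω ∂P := by
    intro n
    refine integral_mono_ae (hGi _) (hGi _) ?_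
    filter_upwards [hlub (S n), hlub s] with ω h1 h2
    refine h1.2 ?_
    rintro _ ⟨k, rfl⟩
    refine h2.1 ⟨Nat.pair n k, ?_⟩
    simp only [s, Nat.unpair_pair]
  have hmax : (⨆ s, ∫ ω, G s ω ∂P) ≤ ∫ ω, G s ω ∂P := by
    refine le_of_forall_pos_lt_add fun ε hε => ?_
    obtain ⟨n, hn⟩ := exists_nat_one_div_lt hε
    have := hS n
    have := hle n
    linarith
  refine ⟨AEEqFun.mk (G s) (hGm s).aestronglyMeasurable, s, ⟨?_, ?_⟩, ?_⟩
  · rintro _ ⟨i, rfl⟩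
    -- Adjoining i to the maximizing sequence cannot increase the integral, so it changes the
    -- supremum only on a null set.
    let s' : ℕ → ι := fun k => Nat.casesOn k i s
    have h1 : G s ≤ᵐ[P] G s' := by
      filter_upwards [hlub s, hlub s'] with ω h1 h2
      refine h1.2 ?_
      rintro _ ⟨k, rfl⟩
      exact h2.1 ⟨k + 1, rfl⟩
    have h2 : ∫ ω, G s ω ∂P = ∫ ω, G s' ω ∂P :=
      le_antisymm (integral_mono_ae (hGi _) (hGi _) h1) ((le_ciSup hbdd s').trans hmax)
    refine le_of_ae_le ?_
    filter_upwards [(integral_eq_iff_of_ae_le (hGi _) (hGi _) h1).1 h2, hlub s',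
      AEEqFun.coeFn_mk (G s) (hGm s).aestronglyMeasurable] with ω h3 h4 h5
    rw [h5, h3]
    exact h4.1 ⟨0, rfl⟩
  · intro Z hZ
    refine le_of_ae_le ?_
    filter_upwards [ae_all_iff.2 fun k => ae_le_of_le (hZ ⟨s k, rfl⟩), hlub s,
      AEEqFun.coeFn_mk (G s) (hGm s).aestronglyMeasurable] with ω h3 h4 h5
    rw [h5]
    refine h4.2 ?_
    rintro _ ⟨k, rfl⟩
    exact h3 k
  · filter_upwards [hlub s, AEEqFun.coeFn_mk (G s) (hGm s).aestronglyMeasurable] with ω h4 h5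
    rwa [h5]

theorem essSupFamily_eq {F : ι → Omega →ₘ[P] ℝ} {Y : Omega →ₘ[P] ℝ} (h : IsLUB (range F) Y) :
    essSupFamily F = Y := by
  have hex : ∃ Y, IsLUB (range F) Y := ⟨Y, h⟩
  rw [essSupFamily, dif_pos hex]
  exact hex.choose_spec.unique h

theorem essInfFamily_eq {F : ι → Omega →ₘ[P] ℝ} {Y : Omega →ₘ[P] ℝ} (h : IsGLB (range F) Y) :
    essInfFamily F = Y := by
  have hex : ∃ Y, IsGLB (range F) Y := ⟨Y, h⟩
  rw [essInfFamily, dif_pos hex]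
  exact hex.choose_spec.unique h

theorem essSupFamily_spec [Nonempty ι] (F : ι → Omega →ₘ[P] ℝ) {C : ℝ}
    (hC : ∀ i, ∀ᵐ ω ∂P, |F i ω| ≤ C) :
    IsLUB (range F) (essSupFamily F) ∧
      ∃ s : ℕ → ι, ∀ᵐ ω ∂P, IsLUB (range fun k => F (s k) ω) (essSupFamily F ω) := by
  obtain ⟨Y, s, h1, h2⟩ := exists_isLUB_seq F hC
  rw [essSupFamily_eq h1]
  exact ⟨h1, s, h2⟩

theorem ae_abs_neg_le {X : Omega →ₘ[P] ℝ} {C : ℝ} (h : ∀ᵐ ω ∂P, |X ω| ≤ C) :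
    ∀ᵐ ω ∂P, |(-X) ω| ≤ C := by
  filter_upwards [h, AEEqFun.coeFn_neg X] with ω h1 h2
  rwa [h2, Pi.neg_apply, abs_neg]

theorem essInfFamily_spec [Nonempty ι] (F : ι → Omega →ₘ[P] ℝ) {C : ℝ}
    (hC : ∀ i, ∀ᵐ ω ∂P, |F i ω| ≤ C) :
    IsGLB (range F) (essInfFamily F) ∧
      ∃ s : ℕ → ι, ∀ᵐ ω ∂P, IsGLB (range fun k => F (s k) ω) (essInfFamily F ω) := by
  obtain ⟨Y, s, h1, h2⟩ := exists_isLUB_seq (fun i => -F i) (fun i => ae_abs_neg_le (hC i))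
  have h3 : IsGLB (range F) (-Y) := by simpa using isGLB_neg_range h1
  rw [essInfFamily_eq h3]
  refine ⟨h3, s, ?_⟩
  filter_upwards [h2, AEEqFun.coeFn_neg Y, ae_all_iff.2 fun k => AEEqFun.coeFn_neg (F (s k))]
    with ω h4 h5 h6
  rw [h5, Pi.neg_apply]
  constructor
  · rintro _ ⟨k, rfl⟩
    have := h4.1 ⟨k, rfl⟩
    simp only [h6, Pi.neg_apply] at this
    linarith
  · intro z hz
    refine le_neg.1 (h4.2 ?_)
    rintro _ ⟨k, rfl⟩
    simp only [h6, Pi.neg_apply]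
    exact neg_le_neg (hz ⟨k, rfl⟩)

theorem essInfFamily_abs_le [Nonempty ι] (F : ι → Omega →ₘ[P] ℝ) {C : ℝ}
    (hC : ∀ i, ∀ᵐ ω ∂P, |F i ω| ≤ C) : ∀ᵐ ω ∂P, |essInfFamily F ω| ≤ C := by
  obtain ⟨-, s, hs⟩ := essInfFamily_spec F hC
  filter_upwards [hs, ae_all_iff.2 fun k => hC (s k)] with ω h1 h2
  refine abs_le.2 ⟨h1.2 ?_, (h1.1 ⟨0, rfl⟩).trans (abs_le.1 (h2 0)).2⟩
  rintro _ ⟨k, rfl⟩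
  exact (abs_le.1 (h2 k)).1

theorem essInfFamily_neg [Nonempty ι] (F : ι → Omega →ₘ[P] ℝ) {C : ℝ}
    (hC : ∀ i, ∀ᵐ ω ∂P, |F i ω| ≤ C) :
    essInfFamily (fun i => -F i) = -essSupFamily F :=
  essInfFamily_eq (isGLB_neg_range (essSupFamily_spec F hC).1)

theorem essSupFamily_neg [Nonempty ι] (F : ι → Omega →ₘ[P] ℝ) {C : ℝ}
    (hC : ∀ i, ∀ᵐ ω ∂P, |F i ω| ≤ C) :
    essSupFamily (fun i => -F i) = -essInfFamily F :=
  essSupFamily_eq (isLUB_neg_range (essInfFamily_spec F hC).1)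

theorem essSupFamily_abs_le [Nonempty ι] (F : ι → Omega →ₘ[P] ℝ) {C : ℝ}
    (hC : ∀ i, ∀ᵐ ω ∂P, |F i ω| ≤ C) : ∀ᵐ ω ∂P, |essSupFamily F ω| ≤ C := by
  have h := ae_abs_neg_le
    (essInfFamily_abs_le (fun i => -F i) (fun i => ae_abs_neg_le (hC i)))
  rwa [essInfFamily_neg F hC, neg_neg] at h

end EssentialBounds

/-- Measurable selection of an index from countably many events. -/
theorem exists_measurable_selector (m : MeasurableSpace Omega) (S : ℕ → Set Omega)
    (hS : ∀ k, MeasurableSet[m] (S k)) :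
    ∃ κ : Omega → ℕ, Measurable[m] κ ∧ ∀ ω, (∃ k, ω ∈ S k) → ω ∈ S (κ ω) := by
  classical
  have hp : ∀ ω, ∃ k, ω ∈ S k ∨ ∀ l, ω ∉ S l := by
    intro ω
    by_cases h : ∃ k, ω ∈ S k
    · exact h.imp fun k hk => .inl hk
    · exact ⟨0, .inr (not_exists.1 h)⟩
  refine ⟨fun ω => Nat.find (hp ω), ?_, ?_⟩
  · refine measurable_find hp fun k => ?_
    have : {ω | ω ∈ S k ∨ ∀ l, ω ∉ S l} = S k ∪ (⋃ l, S l)ᶜ := by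
      ext ω
      simp
    rw [this]
    exact (hS k).union (MeasurableSet.iUnion hS).compl
  · rintro ω ⟨k, hk⟩
    exact (Nat.find_spec (hp ω)).resolve_right fun h => h k hk

/-! ### Games with a pathwise pay-off -/

section Games

variable {T : ℝ} {π : TimePartition T} {t t' : ℝ} {i i' : ℕ}
  {𝒦 𝒦' : ℕ → MeasurableSpace Omega} {A B : Type*} [MeasurableSpace A] [MeasurableSpace B]

/-- `J α β` is the conditional expectation given `F_i` of the pay-off `Φ` of the control paths
which belong to the couple `α`, `β` of strategies over `[t,T]`. -/
structure IsGamePayoff (π : TimePartition T) (t : ℝ) (i : ℕ) (𝒦 𝒦' : ℕ → MeasurableSpace Omega)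
    (Φ : (ℝ → A) → (ℝ → B) → ℝ) (C : ℝ)
    (J : NADStrategy π t 𝒦' B 𝒦 A → NADStrategy π t 𝒦 A 𝒦' B → Omega →ₘ[P] ℝ) : Prop where
  node_le : π.node i ≤ t
  le_n : i ≤ π.n
  bound : ∀ a b, |Φ a b| ≤ C
  meas : ∀ (u : Control π 𝒦 A) (v : Control π 𝒦' B),
    AEStronglyMeasurable (fun ω => Φ (fun s => u.1 s ω) (fun s => v.1 s ω)) P
  congr : ∀ a a' b b', (∀ᵐ s : ℝ, t ≤ s → s ≤ T → a s = a' s) →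
    (∀ᵐ s : ℝ, t ≤ s → s ≤ T → b s = b' s) → Φ a b = Φ a' b'
  exists_couple : ∀ (α : NADStrategy π t 𝒦' B 𝒦 A) (β : NADStrategy π t 𝒦 A 𝒦' B),
    ∃ u v, IsCouple α β u v
  ae_eq : ∀ α β u v, IsCouple α β u v →
    J α β =ᵐ[P] P[fun ω => Φ (fun s => u.1 s ω) (fun s => v.1 s ω)|pastField i]

variable {Φ Φ' : (ℝ → A) → (ℝ → B) → ℝ} {C C' : ℝ}
  {J : NADStrategy π t 𝒦' B 𝒦 A → NADStrategy π t 𝒦 A 𝒦' B → Omega →ₘ[P] ℝ}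
  {J' : NADStrategy π t' 𝒦' B 𝒦 A → NADStrategy π t' 𝒦 A 𝒦' B → Omega →ₘ[P] ℝ}

namespace IsGamePayoff

theorem integrable (hJ : IsGamePayoff π t i 𝒦 𝒦' Φ C J) (u : Control π 𝒦 A)
    (v : Control π 𝒦' B) :
    Integrable (fun ω => Φ (fun s => u.1 s ω) (fun s => v.1 s ω)) P :=
  Integrable.of_bound (hJ.meas u v) C (ae_of_all _ fun _ => hJ.bound _ _)

theorem abs_le (hJ : IsGamePayoff π t i 𝒦 𝒦' Φ C J) (α : NADStrategy π t 𝒦' B 𝒦 A)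
    (β : NADStrategy π t 𝒦 A 𝒦' B) : ∀ᵐ ω ∂P, |J α β ω| ≤ C := by
  obtain ⟨u, v, h⟩ := hJ.exists_couple α β
  have h1 := condExp_mono (m := pastField i) (hJ.integrable u v) (integrable_const C)
    (ae_of_all _ fun _ => (_root_.abs_le.1 (hJ.bound _ _)).2)
  have h2 := condExp_mono (m := pastField i) (integrable_const (-C)) (hJ.integrable u v)
    (ae_of_all _ fun _ => (_root_.abs_le.1 (hJ.bound _ _)).1)
  rw [condExp_const (pastField_le i)] at h1 h2
  filter_upwards [h1, h2, hJ.ae_eq α β u v h] with ω h1 h2 h3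
  rw [h3]
  exact _root_.abs_le.2 ⟨h2, h1⟩

/-- The game in which the second player maximizes. -/
theorem swap_neg (hJ : IsGamePayoff π t i 𝒦 𝒦' Φ C J) :
    IsGamePayoff π t i 𝒦' 𝒦 (fun b a => -Φ a b) C (fun β α => -J α β) where
  node_le := hJ.node_le
  le_n := hJ.le_n
  bound b a := by
    rw [abs_neg]
    exact hJ.bound a b
  meas v u := (hJ.meas u v).neg
  congr b b' a a' hb ha := by rw [hJ.congr a a' b b' ha hb]
  exists_couple β α := by
    obtain ⟨u, v, h⟩ := hJ.exists_couple α β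
    exact ⟨v, u, h.swap⟩
  ae_eq β α v u h := by
    filter_upwards [AEEqFun.coeFn_neg (J α β), hJ.ae_eq α β u v h.swap,
      condExp_neg (fun ω => Φ (fun s => u.1 s ω) (fun s => v.1 s ω)) (pastField i) (μ := P)]
      with ω h1 h2 h3
    rw [h1, Pi.neg_apply, h2]
    exact h3.symm

/-- Both couples of controls agree on S, and the indicator of an event of F_i passes through the
conditional expectation. -/
theorem congr_on (hJ : IsGamePayoff π t i 𝒦 𝒦' Φ C J) {S : Set Omega}
    (hS : MeasurableSet[pastField i] S) {α α' : NADStrategy π t 𝒦' B 𝒦 A}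
    {β β' : NADStrategy π t 𝒦 A 𝒦' B}
    (hα : ∀ v, AgreeOnSet t T S (α.toFun v) (α'.toFun v))
    (hβ : ∀ u, AgreeOnSet t T S (β.toFun u) (β'.toFun u)) :
    ∀ᵐ ω ∂P, ω ∈ S → J α β ω = J α' β' ω := by
  obtain ⟨u, v, h⟩ := hJ.exists_couple α β
  obtain ⟨u', v', h'⟩ := hJ.exists_couple α' β'
  obtain ⟨hu, hv⟩ := h.agreeOnSet hJ.node_le hJ.le_n hS hα hβ h'
  have hind : S.indicator (fun ω => Φ (fun s => u.1 s ω) (fun s => v.1 s ω)) =ᵐ[P]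
      S.indicator (fun ω => Φ (fun s => u'.1 s ω) (fun s => v'.1 s ω)) := by
    filter_upwards [hu.ae_path, hv.ae_path] with ω h1 h2
    by_cases hω : ω ∈ S
    · simp only [indicator_of_mem hω]
      exact hJ.congr _ _ _ _ (h1 hω) (h2 hω)
    · simp only [indicator_of_notMem hω]
  filter_upwards [hJ.ae_eq α β u v h, hJ.ae_eq α' β' u' v' h',
    condExp_indicator (hJ.integrable u v) hS, condExp_indicator (hJ.integrable u' v') hS,
    condExp_congr_ae (m := pastField i) hind] with ω h1 h2 h3 h4 h5 hω
  rw [h3, h4, indicator_of_mem hω, indicator_of_mem hω] at h5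
  rw [h1, h2, h5]

theorem conj_payoff (hJ : IsGamePayoff π t i 𝒦 𝒦' Φ C J) {σ σ' : Omega → Omega}
    (h₁ : IsSymmetry 𝒦 σ) (h₁' : IsSymmetry 𝒦 σ') (h₂ : IsSymmetry 𝒦' σ) (h₂' : IsSymmetry 𝒦' σ')
    (hinv : ∀ᵐ ω ∂P, σ' (σ ω) = ω) (hinv' : ∀ᵐ ω ∂P, σ (σ' ω) = ω)
    (α : NADStrategy π t 𝒦' B 𝒦 A) (β : NADStrategy π t 𝒦 A 𝒦' B) :
    ∀ᵐ ω ∂P, J (α.conj h₂' h₁ hinv) β ω = J α (β.conj h₁ h₂' hinv') (σ ω) := by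
  obtain ⟨u, v, h⟩ := hJ.exists_couple α (β.conj h₁ h₂' hinv')
  have h' := h.conj hJ.node_le hJ.le_n h₁ h₂ h₂' hinv hinv'
  filter_upwards [h₁.preserving.quasiMeasurePreserving.ae (hJ.ae_eq _ _ _ _ h),
    hJ.ae_eq _ _ _ _ h', condExp_comp_symmetry i h₁ h₁' hinv (hJ.integrable u v)]
    with ω e1 e2 e3
  rw [e1, e2, e3]
  rfl

/-! ### Near-optimal play and constancy of the value -/

section Values

variable [Nonempty B]

theorem isGLB_essInf (hJ : IsGamePayoff π t i 𝒦 𝒦' Φ C J) (α : NADStrategy π t 𝒦' B 𝒦 A) :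
    IsGLB (range (J α)) (essInfFamily (J α)) :=
  (essInfFamily_spec _ (hJ.abs_le α)).1

theorem essInf_abs_le (hJ : IsGamePayoff π t i 𝒦 𝒦' Φ C J) (α : NADStrategy π t 𝒦' B 𝒦 A) :
    ∀ᵐ ω ∂P, |essInfFamily (J α) ω| ≤ C :=
  essInfFamily_abs_le _ (hJ.abs_le α)

/-- A nearly optimal answer to a given strategy. -/
theorem exists_response (hJ : IsGamePayoff π t i 𝒦 𝒦' Φ C J) (α : NADStrategy π t 𝒦' B 𝒦 A)
    {c c' : ℝ} (hc : ∀ᵐ ω ∂P, essInfFamily (J α) ω ≤ c) (hcc : c < c') :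
    ∃ β, ∀ᵐ ω ∂P, J α β ω ≤ c' := by
  obtain ⟨-, β, hβ⟩ := essInfFamily_spec _ (hJ.abs_le α)
  choose u v huv using fun k => hJ.exists_couple α (β k)
  let j : ℕ → Omega → ℝ := fun k =>
    P[fun ω => Φ (fun s => (u k).1 s ω) (fun s => (v k).1 s ω)|pastField i]
  have hj : ∀ k, J α (β k) =ᵐ[P] j k := fun k => hJ.ae_eq _ _ _ _ (huv k)
  obtain ⟨κ, hκ, hκ'⟩ := exists_measurable_selector (pastField i) (fun k => j k ⁻¹' Iio c')
    fun k => (stronglyMeasurable_condExp (μ := P) (m := pastField i)).measurable measurableSet_Iio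
  let b : B := Classical.arbitrary B
  refine ⟨NADStrategy.paste hJ.node_le hJ.le_n κ hκ b β, ?_⟩
  have hloc := ae_all_iff.2 fun k => hJ.congr_on (hκ (measurableSet_singleton k)) (α := α)
    (fun v => ae_of_all _ fun _ _ _ _ => rfl)
    (NADStrategy.paste_agreeOnSet hJ.node_le hJ.le_n κ hκ b β k)
  filter_upwards [hloc, ae_all_iff.2 hj, hβ, hc] with ω e1 e2 e3 e4
  rw [e1 (κ ω) rfl, e2]
  obtain ⟨_, ⟨k, rfl⟩, hk⟩ := (isGLB_lt_iff e3).1 (e4.trans_lt hcc)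
  exact (hκ' ω ⟨k, by rw [mem_preimage, ← e2]; exact hk⟩).le

/-- The countable infimum of conditional expectations is an F_i-measurable version, from which
`exists_near_optimal` selects. -/
theorem exists_measurable_essInf (hJ : IsGamePayoff π t i 𝒦 𝒦' Φ C J)
    (α : NADStrategy π t 𝒦' B 𝒦 A) :
    ∃ w : Omega → ℝ, Measurable[pastField i] w ∧ essInfFamily (J α) =ᵐ[P] w := by
  obtain ⟨-, β, hβ⟩ := essInfFamily_spec _ (hJ.abs_le α)
  choose u v huv using fun k => hJ.exists_couple α (β k)
  refine ⟨fun ω => ⨅ k,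
    (P[fun ω => Φ (fun s => (u k).1 s ω) (fun s => (v k).1 s ω)|pastField i]) ω, ?_, ?_⟩
  · exact Measurable.iInf fun k => stronglyMeasurable_condExp.measurable
  · filter_upwards [hβ, ae_all_iff.2 fun k => hJ.ae_eq _ _ _ _ (huv k)] with ω e1 e2
    simp only [← e2]
    exact e1.ciInf_eq.symm

variable [Nonempty A]

theorem isLUB_value (hJ : IsGamePayoff π t i 𝒦 𝒦' Φ C J) :
    IsLUB (range fun α => essInfFamily (J α)) (essSupFamily fun α => essInfFamily (J α)) :=
  (essSupFamily_spec _ hJ.essInf_abs_le).1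

/-- The value of the swapped game. -/
theorem value_swap_neg (hJ : IsGamePayoff π t i 𝒦 𝒦' Φ C J) :
    (essSupFamily fun β => essInfFamily fun α => -J α β) =
      -essInfFamily fun β => essSupFamily fun α => J α β := by
  have h : ∀ β, (essInfFamily fun α => -J α β) = -essSupFamily fun α => J α β :=
    fun β => essInfFamily_neg _ fun α => hJ.abs_le α β
  simp only [h]
  exact essSupFamily_neg _ fun β => essSupFamily_abs_le _ fun α => hJ.abs_le α β

/-- Conjugating α by σ composes its guaranteed pay-off with σ, since the opponent's answers can be
conjugated as well. One inequality suffices: exchanging σ and σ' gives the other. -/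
theorem value_le_comp (hJ : IsGamePayoff π t i 𝒦 𝒦' Φ C J) {σ σ' : Omega → Omega}
    (h₁ : IsSymmetry 𝒦 σ) (h₁' : IsSymmetry 𝒦 σ') (h₂ : IsSymmetry 𝒦' σ) (h₂' : IsSymmetry 𝒦' σ')
    (hinv : ∀ᵐ ω ∂P, σ' (σ ω) = ω) (hinv' : ∀ᵐ ω ∂P, σ (σ' ω) = ω) :
    ∀ᵐ ω ∂P, (essSupFamily fun α => essInfFamily (J α)) ω ≤
      (essSupFamily fun α => essInfFamily (J α)) (σ' ω) := by
  set V := essSupFamily fun α => essInfFamily (J α) with hV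
  have hp := h₁.preserving
  have hp' := h₁'.preserving
  have key : V ≤ V.compMeasurePreserving σ' hp' := by
    refine hJ.isLUB_value.2 ?_
    rintro _ ⟨α, rfl⟩
    have hle : (essInfFamily (J α)).compMeasurePreserving σ hp ≤
        essInfFamily (J (α.conj h₂' h₁ hinv)) := by
      refine (hJ.isGLB_essInf _).2 ?_
      rintro _ ⟨β, rfl⟩
      refine le_of_ae_le ?_
      filter_upwards [AEEqFun.coeFn_compMeasurePreserving (essInfFamily (J α)) hp,
        hJ.conj_payoff h₁ h₁' h₂ h₂' hinv hinv' α β,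
        hp.quasiMeasurePreserving.ae
          (ae_le_of_le ((hJ.isGLB_essInf α).1 ⟨β.conj h₁ h₂' hinv', rfl⟩))] with ω e1 e2 e3
      rw [e1, e2]
      exact e3
    refine le_of_ae_le ?_
    filter_upwards [AEEqFun.coeFn_compMeasurePreserving V hp', hinv',
      hp'.quasiMeasurePreserving.ae
        (AEEqFun.coeFn_compMeasurePreserving (essInfFamily (J α)) hp),
      hp'.quasiMeasurePreserving.ae (ae_le_of_le hle),
      hp'.quasiMeasurePreserving.ae
        (ae_le_of_le (hJ.isLUB_value.1 ⟨α.conj h₂' h₁ hinv, rfl⟩))] with ω e1 e2 e3 e4 e5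
    rw [e1]
    rw [e3, Function.comp_apply, e2] at e4
    exact e4.trans e5
  filter_upwards [ae_le_of_le key, AEEqFun.coeFn_compMeasurePreserving V hp'] with ω e1 e2
  rwa [e2] at e1

/-- The value of a game which is invariant under rotations is deterministic. -/
theorem value_ae_eq_const (hJ : IsGamePayoff π t i 𝒦 𝒦' Φ C J)
    (h : ∀ θ, IsSymmetry 𝒦 (rotation θ)) (h' : ∀ θ, IsSymmetry 𝒦' (rotation θ)) :
    ∀ᵐ ω ∂P, (essSupFamily fun α => essInfFamily (J α)) ω =
      ∫ ω', (essSupFamily fun α => essInfFamily (J α)) ω' ∂P := by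
  refine ae_eq_const_of_rotation_invariant (AEEqFun.measurable _) fun θ => ?_
  have hi := negRotation_rotation θ
  have hi' := negRotation_rotation (negRotation θ)
  rw [negRotation_negRotation] at hi'
  filter_upwards [hJ.value_le_comp (h _) (h _) (h' _) (h' _) hi' hi,
    hi, (measurePreserving_rotation θ).quasiMeasurePreserving.ae
      (hJ.value_le_comp (h _) (h _) (h' _) (h' _) hi hi')] with ω e1 e2 e3
  rw [e2] at e3
  exact le_antisymm e3 e1

/-- A nearly optimal strategy. -/
theorem exists_near_optimal (hJ : IsGamePayoff π t i 𝒦 𝒦' Φ C J) {c c' : ℝ}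
    (hc : ∀ᵐ ω ∂P, c ≤ (essSupFamily fun α => essInfFamily (J α)) ω) (hcc : c' < c) :
    ∃ α, ∀ β, ∀ᵐ ω ∂P, c' ≤ J α β ω := by
  obtain ⟨-, α, hα⟩ := essSupFamily_spec _ hJ.essInf_abs_le
  choose w hw hw' using fun k => hJ.exists_measurable_essInf (α k)
  obtain ⟨κ, hκ, hκ'⟩ := exists_measurable_selector (pastField i) (fun k => w k ⁻¹' Ioi c')
    fun k => hw k measurableSet_Ioi
  let a : A := Classical.arbitrary A
  refine ⟨NADStrategy.paste hJ.node_le hJ.le_n κ hκ a α, fun β => ?_⟩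
  have hloc := ae_all_iff.2 fun k => hJ.congr_on (hκ (measurableSet_singleton k)) (β := β)
    (NADStrategy.paste_agreeOnSet hJ.node_le hJ.le_n κ hκ a α k)
    (fun v => ae_of_all _ fun _ _ _ _ => rfl)
  filter_upwards [hloc, ae_all_iff.2 hw', hα, hc,
    ae_all_iff.2 fun k => ae_le_of_le ((hJ.isGLB_essInf (α k)).1 ⟨β, rfl⟩)] with ω e1 e2 e3 e4 e5
  rw [e1 (κ ω) rfl]
  obtain ⟨_, ⟨k, rfl⟩, hk⟩ := (lt_isLUB_iff e3).1 (hcc.trans_le e4)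
  have := hκ' ω ⟨k, by rw [mem_preimage, ← e2]; exact hk⟩
  rw [mem_preimage, ← e2] at this
  exact (mem_Ioi.1 this).le.trans (e5 _)

end Values

/-- Conditional pay-offs of two games along couples of controls which coincide on the smaller
time interval. -/
theorem le_of_le (hJ : IsGamePayoff π t i 𝒦 𝒦' Φ C J) (hJ' : IsGamePayoff π t' i' 𝒦 𝒦' Φ' C' J')
    (hii : i ≤ i') {δ r : ℝ}
    (hΦ : ∀ a b, Measurable a → Measurable b → |Φ a b - Φ' a b| ≤ δ)
    {α : NADStrategy π t 𝒦' B 𝒦 A} {β : NADStrategy π t 𝒦 A 𝒦' B}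
    {α' : NADStrategy π t' 𝒦' B 𝒦 A} {β' : NADStrategy π t' 𝒦 A 𝒦' B}
    {u u' : Control π 𝒦 A} {v v' : Control π 𝒦' B}
    (h : IsCouple α β u v) (h' : IsCouple α' β' u' v')
    (hu : AgreeOn t' (fun _ => T) u u') (hv : AgreeOn t' (fun _ => T) v v')
    (hr : ∀ᵐ ω ∂P, r ≤ J' α' β' ω) : ∀ᵐ ω ∂P, r - δ ≤ J α β ω := by
  have hm := pastField_le i'
  have h1 : ∀ᵐ ω ∂P, Φ' (fun s => u'.1 s ω) (fun s => v'.1 s ω) - δ ≤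
      Φ (fun s => u.1 s ω) (fun s => v.1 s ω) := by
    filter_upwards [(hu.agreeOnSet univ).ae_path, (hv.agreeOnSet univ).ae_path] with ω e1 e2
    rw [← hJ'.congr _ _ _ _ (e1 (mem_univ _)) (e2 (mem_univ _))]
    have := (_root_.abs_le.1 (hΦ _ _ (u.measurable_path ω) (v.measurable_path ω))).1
    linarith
  have h2 := condExp_mono (m := pastField i)
    ((hJ'.integrable u' v').sub (integrable_const δ)) (hJ.integrable u v) h1
  have h3 : (fun _ => r) ≤ᵐ[P]
      P[fun ω => Φ' (fun s => u'.1 s ω) (fun s => v'.1 s ω)|pastField i'] := by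
    filter_upwards [hr, hJ'.ae_eq _ _ _ _ h'] with ω e1 e2
    rwa [← e2]
  -- The bound known given F_{i'} survives conditioning on the smaller F_i because r is a constant;
  -- the tower property then compares it with J.
  have h4 := condExp_mono (m := pastField i) (integrable_const r) integrable_condExp h3
  have h5 := condExp_condExp_of_le (μ := P) (pastField_mono hii) hm
    (f := fun ω => Φ' (fun s => u'.1 s ω) (fun s => v'.1 s ω))
  have h6 := condExp_sub (hJ'.integrable u' v') (integrable_const δ) (pastField i) (μ := P)
  rw [condExp_const (pastField_le i)] at h4 h6
  filter_upwards [hJ.ae_eq _ _ _ _ h, h2, h4, h5, h6] with ω e1 e2 e4 e5 e6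
  rw [e1]
  refine le_trans ?_ e2
  rw [e5] at e4
  have e6' : _ = _ := e6
  simp only [Pi.sub_apply] at e6'
  refine le_trans ?_ e6'.ge
  linarith

variable [Nonempty A] [Nonempty B]

/-- Deterministic values of two games with close pay-offs on different time intervals. -/
theorem abs_value_sub_le (hJ : IsGamePayoff π t i 𝒦 𝒦' Φ C J)
    (hJ' : IsGamePayoff π t' i' 𝒦 𝒦' Φ' C' J') (htt : t ≤ t') (hii : i ≤ i') {δ c c' : ℝ}
    (hΦ : ∀ a b, Measurable a → Measurable b → |Φ a b - Φ' a b| ≤ δ)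
    (hc : ∀ᵐ ω ∂P, (essSupFamily fun α => essInfFamily (J α)) ω = c)
    (hc' : ∀ᵐ ω ∂P, (essSupFamily fun α => essInfFamily (J' α)) ω = c') : |c - c'| ≤ δ := by
  let a : A := Classical.arbitrary A
  let b : B := Classical.arbitrary B
  rw [abs_sub_le_iff]
  constructor
  · refine le_of_forall_pos_le_add fun ε hε => ?_
    -- For c ≤ c' + δ: a good α for the longer game is restricted to [t',T], answered there by a
    -- nearly optimal β', and β' is extended to meet α in the longer game. The pay-off lies above c
    -- - ε/2 there and below c' + ε/2 + δ.
    obtain ⟨α, hα⟩ := hJ.exists_near_optimal (c' := c - ε / 2)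
      (hc.mono fun _ h => h.ge) (by linarith)
    have hW : ∀ᵐ ω ∂P, essInfFamily (J' (α.restrict htt b)) ω ≤ c' := by
      filter_upwards [hc', ae_le_of_le (hJ'.isLUB_value.1 ⟨α.restrict htt b, rfl⟩)] with ω e1 e2
      exact e2.trans_eq e1
    obtain ⟨β', hβ'⟩ := hJ'.exists_response _ hW (c' := c' + ε / 2) (by linarith)
    obtain ⟨u, v, h⟩ := hJ'.exists_couple (α.restrict htt b) β'
    have hcp := (h.swap.extend_restrict htt hJ'.node_le hJ'.le_n b).swap
    -- An upper bound for the pay-off is a lower bound in the swapped, negated game.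
    have hle := hJ.swap_neg.le_of_le hJ'.swap_neg hii (δ := δ) (r := -(c' + ε / 2))
      (fun b a hb ha => by rw [← neg_sub', abs_neg]; exact hΦ a b ha hb) hcp.swap h.swap
      (agreeOn_startAt b t' _ v) h.1 ?_
    · obtain ⟨ω, e1, e2, e3⟩ := (hle.and ((hα (β'.extend htt b)).and
        (AEEqFun.coeFn_neg (J α (β'.extend htt b))))).exists
      rw [e3, Pi.neg_apply] at e1
      linarith
    · filter_upwards [hβ', AEEqFun.coeFn_neg (J' (α.restrict htt b) β')] with ω e1 e2
      rw [e2]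
      exact neg_le_neg e1
  · refine le_of_forall_pos_le_add fun ε hε => ?_
    -- For c' ≤ c + δ: the extension of a good α' guarantees c' - ε - δ against every β, because β
    -- can be restricted to [t',T].
    obtain ⟨α', hα'⟩ := hJ'.exists_near_optimal (c' := c' - ε)
      (hc'.mono fun _ h => h.ge) (by linarith)
    have hW : AEEqFun.const Omega (c' - ε - δ) ≤ essInfFamily (J (α'.extend htt a)) := by
      refine (hJ.isGLB_essInf _).2 ?_
      rintro _ ⟨β, rfl⟩
      obtain ⟨u, v, h⟩ := hJ'.exists_couple α' (β.restrict htt a)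
      have hcp := h.extend_restrict htt hJ'.node_le hJ'.le_n a
      refine le_of_ae_le ?_
      filter_upwards [hJ.le_of_le hJ' hii hΦ hcp h (agreeOn_startAt a t' _ u) h.2 (hα' _),
        AEEqFun.coeFn_const (μ := P) Omega (c' - ε - δ)] with ω e1 e2
      rw [e2]
      exact e1
    obtain ⟨ω, e1, e2, e3, e4⟩ := (hc.and ((ae_le_of_le hW).and
      ((ae_le_of_le (hJ.isLUB_value.1 ⟨α'.extend htt a, rfl⟩)).and
        (AEEqFun.coeFn_const (μ := P) Omega (c' - ε - δ))))).exists
    rw [e4] at e2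
    have : c' - ε - δ ≤ c := e2.trans (e3.trans_eq e1)
    linarith

end IsGamePayoff

end Games

/-! ### Picard iteration for differential equations with a measurable parameter -/

section Picard

open Topology Nat

variable {E : Type*} {Ω : Type*} {M : ℝ}

theorem measurable_picard_integrand [MeasurableSpace E] [MeasurableSpace Ω] {h : ℝ → Ω → E → E}
    (hm : Measurable fun p : ℝ × Ω × E => h p.1 p.2.1 p.2.2)
    {X : ℝ → Ω → E} (hX : Measurable fun p : ℝ × Ω => X p.1 p.2) (ω : Ω) :
    Measurable fun r => h r ω (X r ω) :=
  hm.comp (measurable_id.prodMk (measurable_const.prodMk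
    (hX.comp (measurable_id.prodMk measurable_const))))

theorem intervalIntegrable_of_bound [NormedAddCommGroup E] [MeasurableSpace E] [BorelSpace E]
    [SecondCountableTopology E] {k : ℝ → E} (hk : Measurable k) (hM : ∀ r, ‖k r‖ ≤ M)
    (a b : ℝ) : IntervalIntegrable k volume a b :=
  (intervalIntegrable_const (c := M)).mono_fun hk.aestronglyMeasurable
    (ae_of_all _ fun r => (hM r).trans (le_abs_self M))

variable [NormedAddCommGroup E] [NormedSpace ℝ E]

/-- Picard iterates of the equation `X_s = x + ∫_t^s h(r, ω, X_r) dr`. -/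
noncomputable def picard (h : ℝ → Ω → E → E) (t : ℝ) (x : E) : ℕ → ℝ → Ω → E
  | 0 => fun _ _ => x
  | n + 1 => fun s ω => x + ∫ r in Ioc t s, h r ω (picard h t x n r ω)

theorem picard_succ (h : ℝ → Ω → E → E) {t s : ℝ} (hs : t ≤ s) (x : E) (n : ℕ) (ω : Ω) :
    picard h t x (n + 1) s ω = x + ∫ r in t..s, h r ω (picard h t x n r ω) := by
  rw [intervalIntegral.integral_of_le hs]
  rfl

theorem picard_of_le (h : ℝ → Ω → E → E) {t s : ℝ} (hs : s ≤ t) (x : E) (n : ℕ) (ω : Ω) :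
    picard h t x n s ω = x := by
  cases n with
  | zero => rfl
  | succ n => simp [picard, Ioc_eq_empty hs.not_gt]

variable [MeasurableSpace E] [BorelSpace E] [SecondCountableTopology E]
  [MeasurableSpace Ω] {h : ℝ → Ω → E → E} {K : NNReal}

/-- Each step integrates the indicator of the measurable set t < r ≤ s times a jointly measurable
function, and such integrals are measurable in the remaining variables. -/
theorem measurable_picard (hm : Measurable fun p : ℝ × Ω × E => h p.1 p.2.1 p.2.2) (t : ℝ) (x : E)
    (n : ℕ) : Measurable fun p : ℝ × Ω => picard h t x n p.1 p.2 := by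
  induction n with
  | zero => exact measurable_const
  | succ n ih =>
    have h1 : Measurable fun q : (ℝ × Ω) × ℝ => h q.2 q.1.2 (picard h t x n q.2 q.1.2) :=
      hm.comp (measurable_snd.prodMk ((measurable_snd.comp measurable_fst).prodMk
        (ih.comp (measurable_snd.prodMk (measurable_snd.comp measurable_fst)))))
    have h2 : MeasurableSet {q : (ℝ × Ω) × ℝ | t < q.2 ∧ q.2 ≤ q.1.1} :=
      (measurableSet_lt measurable_const measurable_snd).inter
        (measurableSet_le measurable_snd (measurable_fst.comp measurable_fst))
    have h3 := (h1.indicator h2).stronglyMeasurable.integral_prod_right' (ν := volume)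
    refine measurable_const.add ?_
    convert h3.measurable using 2 with p
    rw [← integral_indicator measurableSet_Ioc]
    rfl

theorem norm_picard_sub_le (hm : Measurable fun p : ℝ × Ω × E => h p.1 p.2.1 p.2.2)
    (hM : ∀ r ω y, ‖h r ω y‖ ≤ M) (hK : ∀ r ω, LipschitzWith K (h r ω)) {t s : ℝ} (hs : t ≤ s)
    (x : E) (n : ℕ) (ω : Ω) :
    ‖picard h t x (n + 1) s ω - picard h t x n s ω‖ ≤
      M * K ^ n * (s - t) ^ (n + 1) / (n + 1)! := by
  induction n generalizing s with
  | zero =>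
    rw [picard_succ h hs]
    have : ‖∫ r in t..s, h r ω (picard h t x 0 r ω)‖ ≤ M * |s - t| :=
      intervalIntegral.norm_integral_le_of_norm_le_const fun r _ => hM _ _ _
    rw [abs_of_nonneg (sub_nonneg.2 hs)] at this
    simpa [picard] using this
  | succ n ih =>
    have hint : ∀ m, IntervalIntegrable (fun r => h r ω (picard h t x m r ω)) volume t s :=
      fun m => intervalIntegrable_of_bound
        (measurable_picard_integrand hm (measurable_picard hm t x m) ω) (fun r => hM _ _ _) _ _
    rw [picard_succ h hs x (n + 1), picard_succ h hs x n, add_sub_add_left_eq_sub,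
      ← intervalIntegral.integral_sub (hint _) (hint _)]
    have hb : ∀ r ∈ Ioc t s, ‖h r ω (picard h t x (n + 1) r ω) - h r ω (picard h t x n r ω)‖ ≤
        K * (M * K ^ n * (r - t) ^ (n + 1) / (n + 1)!) := by
      intro r hr
      rw [← dist_eq_norm]
      refine ((hK r ω).dist_le_mul _ _).trans (mul_le_mul_of_nonneg_left ?_ K.2)
      rw [dist_eq_norm]
      exact ih hr.1.le
    refine (intervalIntegral.norm_integral_le_of_norm_le hs (ae_of_all _ hb)
      (Continuous.intervalIntegrable (by fun_prop) _ _)).trans_eq ?_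
    have hcalc : ∀ r : ℝ, (K : ℝ) * (M * K ^ n * (r - t) ^ (n + 1) / (n + 1)!) =
        (M * K ^ (n + 1) / (n + 1)!) * (r - t) ^ (n + 1) := fun r => by ring
    simp only [hcalc]
    rw [intervalIntegral.integral_const_mul,
      intervalIntegral.integral_comp_sub_right (fun r => r ^ (n + 1)), integral_pow,
      Nat.factorial_succ (n + 1)]
    push_cast
    have h1 : ((n : ℝ) + 1 + 1) ≠ 0 := by positivity
    have h2 : ((n + 1)! : ℝ) ≠ 0 := by positivity
    field_simp
    simp

variable [CompleteSpace E]

/-- A bounded, Lipschitz differential equation has a solution which depends measurably on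
the parameter. -/
theorem exists_measurable_solution (hm : Measurable fun p : ℝ × Ω × E => h p.1 p.2.1 p.2.2)
    (hM : ∀ r ω y, ‖h r ω y‖ ≤ M) (hK : ∀ r ω, LipschitzWith K (h r ω)) (t : ℝ) (x : E) :
    ∃ X : ℝ → Ω → E, (Measurable fun p : ℝ × Ω => X p.1 p.2) ∧
      ∀ ω, ∀ s, t ≤ s → X s ω = x + ∫ r in t..s, h r ω (X r ω) := by
  have hlim : ∀ s ω, ∃ y, Tendsto (fun n => picard h t x n s ω) atTop (𝓝 y) := by
    intro s ω
    rcases le_total s t with hs | hs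
    · exact ⟨x, by simp only [picard_of_le h hs]; exact tendsto_const_nhds⟩
    refine cauchySeq_tendsto_of_complete (cauchySeq_of_dist_le_of_summable
      -- Weakening (n + 1)! to n! in the increment bound gives a multiple of the exponential series.
      (fun n => M * (s - t) * ((K * (s - t)) ^ n / n !)) (fun n => ?_)
      ((Real.summable_pow_div_factorial _).mul_left _))
    rw [_root_.dist_comm, dist_eq_norm]
    refine (norm_picard_sub_le hm hM hK hs x n ω).trans ?_
    have hM0 : 0 ≤ M := (norm_nonneg _).trans (hM s ω x)
    have hs0 : 0 ≤ s - t := sub_nonneg.2 hs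
    have h1 : M * (s - t) * ((K * (s - t)) ^ n / n !) =
        M * K ^ n * (s - t) ^ (n + 1) / n ! := by
      rw [mul_pow]
      ring
    rw [h1]
    refine div_le_div_of_nonneg_left (by positivity) (by positivity) ?_
    exact_mod_cast Nat.factorial_le (Nat.le_succ n)
  choose X hX using hlim
  have hXm : Measurable fun p : ℝ × Ω => X p.1 p.2 :=
    measurable_of_tendsto_metrizable (measurable_picard hm t x)
      (tendsto_pi_nhds.2 fun p => hX p.1 p.2)
  refine ⟨X, hXm, fun ω s hs => ?_⟩
  refine tendsto_nhds_unique ((tendsto_add_atTop_iff_nat 1).2 (hX s ω)) ?_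
  simp only [picard_succ h hs]
  refine tendsto_const_nhds.add ?_
  refine intervalIntegral.tendsto_integral_filter_of_dominated_convergence (fun _ => M)
    (Eventually.of_forall fun n => ?_) (Eventually.of_forall fun n => ae_of_all _ fun r _ => hM _ _ _)
    intervalIntegrable_const (ae_of_all _ fun r _ => ?_)
  · exact (measurable_picard_integrand hm (measurable_picard hm t x n) ω).aestronglyMeasurable
  · exact ((hK r ω).continuous.tendsto _).comp (hX r ω)

end Picard

/-- Grönwall's inequality in integral form. -/
theorem le_mul_exp_of_le_add_integral {φ : ℝ → ℝ} {a b δ K : ℝ} (hab : a ≤ b)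
    (hφ : ContinuousOn φ (Icc a b)) (hφ0 : ∀ s ∈ Icc a b, 0 ≤ φ s) (hδ : 0 ≤ δ) (hK : 0 ≤ K)
    (h : ∀ s ∈ Icc a b, φ s ≤ δ + K * ∫ r in a..s, φ r) : φ b ≤ δ * Real.exp (K * (b - a)) := by
  -- The continuous extension of φ makes the majorant F differentiable everywhere, with F' = Kψ ≤ KF
  -- on [a,b]; the differential form of Grönwall's inequality then applies.
  let ψ : ℝ → ℝ := IccExtend hab ((Icc a b).domRestrict φ)
  have hψ : Continuous ψ := (continuousOn_iff_continuous_domRestrict.1 hφ).Icc_extend'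
  have hψφ : ∀ s ∈ Icc a b, ψ s = φ s := fun s hs => IccExtend_of_mem hab _ hs
  have hψ0 : ∀ s, 0 ≤ ψ s := fun s => hφ0 _ (projIcc a b hab s).2
  have hint : ∀ s ∈ Icc a b, ∫ r in a..s, φ r = ∫ r in a..s, ψ r := by
    intro s hs
    refine intervalIntegral.integral_congr fun r hr => ?_
    rw [uIcc_of_le hs.1] at hr
    exact (hψφ r ⟨hr.1, hr.2.trans hs.2⟩).symm
  let F : ℝ → ℝ := fun s => δ + K * ∫ r in a..s, ψ r
  have hF : ∀ s, HasDerivAt F (K * ψ s) s := fun s =>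
    ((hψ.integral_hasStrictDerivAt a s).hasDerivAt.const_mul K).const_add δ
  have hF0 : ∀ s ∈ Icc a b, 0 ≤ F s := fun s hs =>
    add_nonneg hδ (mul_nonneg hK (intervalIntegral.integral_nonneg hs.1 fun r _ => hψ0 r))
  have hle : ∀ s ∈ Icc a b, ψ s ≤ F s := by
    intro s hs
    rw [hψφ s hs]
    exact (h s hs).trans_eq (by rw [hint s hs])
  have := norm_le_gronwallBound_of_norm_deriv_right_le (f := F) (f' := fun s => K * ψ s) (δ := δ)
    (K := K) (ε := 0) (a := a) (b := b) (fun s _ => (hF s).continuousAt.continuousWithinAt)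
    (fun s _ => (hF s).hasDerivWithinAt) (by simp [F, abs_of_nonneg hδ])
    (fun s hs => by
      have hs' : s ∈ Icc a b := ⟨hs.1, hs.2.le⟩
      rw [add_zero, Real.norm_of_nonneg (mul_nonneg hK (hψ0 s)), Real.norm_of_nonneg (hF0 s hs')]
      exact mul_le_mul_of_nonneg_left (hle s hs') hK) b ⟨hab, le_rfl⟩
  rw [gronwallBound_ε0] at this
  have hb : b ∈ Icc a b := ⟨hab, le_rfl⟩
  rw [← hψφ b hb]
  exact (hle b hb).trans ((Real.le_norm_self _).trans this)

/-! ### Trajectories -/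

section Trajectories

variable {d : ℕ} {U V : Type*} {f : ℝ → State d → U → V → State d} {T M : ℝ} {K : NNReal}
  {t t' : ℝ} {x x' : State d}

theorem trajectory_spec {a : ℝ → U} {b : ℝ → V}
    (hex : ∃ X, IsTrajectory f T t x a b X) :
    IsTrajectory f T t x a b (trajectory f T t x a b) := by
  have : trajectory f T t x a b = hex.choose := by
    funext s
    rw [trajectory, dif_pos hex]
  rw [this]
  exact hex.choose_spec

theorem isTrajectory_congr {a a' : ℝ → U} {b b' : ℝ → V}
    (ha : ∀ᵐ s : ℝ, t ≤ s → s ≤ T → a s = a' s) (hb : ∀ᵐ s : ℝ, t ≤ s → s ≤ T → b s = b' s)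
    {X : ℝ → State d} (h : IsTrajectory f T t x a b X) : IsTrajectory f T t x a' b' X := by
  refine ⟨h.1, fun s hs => (h.2 s hs).trans ?_⟩
  congr 1
  refine intervalIntegral.integral_congr_ae ?_
  filter_upwards [ha, hb] with r h1 h2 hr
  rw [uIoc_of_le hs.1] at hr
  rw [h1 hr.1.le (hr.2.trans hs.2), h2 hr.1.le (hr.2.trans hs.2)]

/-- The two solution predicates are equal, hence so are the chosen solutions. Neither existence nor
uniqueness is involved, so arbitrary, possibly nonmeasurable paths are covered. -/
theorem trajectory_congr {a a' : ℝ → U} {b b' : ℝ → V}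
    (ha : ∀ᵐ s : ℝ, t ≤ s → s ≤ T → a s = a' s) (hb : ∀ᵐ s : ℝ, t ≤ s → s ≤ T → b s = b' s) :
    trajectory f T t x a b = trajectory f T t x a' b' := by
  have ha' := ha.mono fun s h h1 h2 => (h h1 h2).symm
  have hb' := hb.mono fun s h h1 h2 => (h h1 h2).symm
  have : IsTrajectory f T t x a b = IsTrajectory f T t x a' b' :=
    funext fun X => propext ⟨isTrajectory_congr ha hb, isTrajectory_congr ha' hb'⟩
  unfold trajectory
  rw [this]

variable [MeasurableSpace U] [MeasurableSpace V]

/-- The right-hand side of the controlled differential equation is jointly measurable, bounded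
and Lipschitz in the state variable on `[0,T]`. -/
structure IsDynamics (f : ℝ → State d → U → V → State d) (T M : ℝ) (K : NNReal) : Prop where
  meas : Measurable fun p : ℝ × State d × U × V =>
    (Icc 0 T).indicator (fun r => f r p.2.1 p.2.2.1 p.2.2.2) p.1
  bound : ∀ s ∈ Icc 0 T, ∀ x a b, ‖f s x a b‖ ≤ M
  lipschitz : ∀ s ∈ Icc 0 T, ∀ a b, LipschitzWith K fun x => f s x a b

theorem IsDynamics.nonneg [Nonempty U] [Nonempty V] (hf : IsDynamics f T M K) (hT : 0 ≤ T) :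
    0 ≤ M :=
  (norm_nonneg _).trans (hf.bound 0 ⟨le_rfl, hT⟩ 0 (Classical.arbitrary U) (Classical.arbitrary V))

/-- Cutting f off outside [0,T] makes it globally measurable, bounded and Lipschitz, so Picard
iteration applies. The parameter space is Ω for measurability in the randomness and a point for a
single path. -/
theorem IsDynamics.exists_trajectory [Nonempty U] [Nonempty V] (hf : IsDynamics f T M K)
    (ht : t ∈ Icc 0 T) (x : State d) {Ω : Type*} [MeasurableSpace Ω]
    {u : ℝ → Ω → U} {v : ℝ → Ω → V} (hu : Measurable fun p : ℝ × Ω => u p.1 p.2)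
    (hv : Measurable fun p : ℝ × Ω => v p.1 p.2) :
    ∃ X : ℝ → Ω → State d, (Measurable fun p : ℝ × Ω => X p.1 p.2) ∧
      ∀ ω, IsTrajectory f T t x (fun s => u s ω) (fun s => v s ω) (fun s => X s ω) := by
  have hM := hf.nonneg (ht.1.trans ht.2)
  let h : ℝ → Ω → State d → State d := fun r ω y =>
    (Icc 0 T).indicator (fun r => f r y (u r ω) (v r ω)) r
  have hh : ∀ r ∈ Icc 0 T, ∀ ω y, h r ω y = f r y (u r ω) (v r ω) := fun r hr ω y =>
    indicator_of_mem hr _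
  have hm : Measurable fun p : ℝ × Ω × State d => h p.1 p.2.1 p.2.2 := by
    have hp : Measurable fun p : ℝ × Ω × State d => (p.1, p.2.1) := by fun_prop
    have := hf.meas.comp (measurable_fst.prodMk
      ((measurable_snd.comp measurable_snd).prodMk ((hu.comp hp).prodMk (hv.comp hp))))
    convert this using 1
    funext p
    simp only [h, Function.comp_apply]
    by_cases hp : p.1 ∈ Icc 0 T
    · rw [indicator_of_mem hp, indicator_of_mem hp]
    · rw [indicator_of_notMem hp, indicator_of_notMem hp]
  have hb : ∀ r ω y, ‖h r ω y‖ ≤ M := by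
    intro r ω y
    by_cases hr : r ∈ Icc 0 T
    · rw [hh r hr]
      exact hf.bound r hr _ _ _
    · simpa only [h, indicator_of_notMem hr, norm_zero] using hM
  have hl : ∀ r ω, LipschitzWith K (h r ω) := by
    intro r ω
    by_cases hr : r ∈ Icc 0 T
    · exact funext (hh r hr ω) ▸ hf.lipschitz r hr _ _
    · have : h r ω = fun _ => 0 := funext fun y => indicator_of_notMem hr _
      rw [this]
      exact LipschitzWith.const' 0
  obtain ⟨X, hX, hX'⟩ := exists_measurable_solution hm hb hl t x
  refine ⟨X, hX, fun ω => ⟨?_, fun s hs => ?_⟩⟩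
  · have hc : Continuous fun s => x + ∫ r in t..s, h r ω (X r ω) :=
      continuous_const.add (intervalIntegral.continuous_primitive (fun a b =>
        intervalIntegrable_of_bound (measurable_picard_integrand hm hX ω)
          (fun r => hb _ _ _) a b) t)
    exact hc.continuousOn.congr fun s hs => hX' ω s hs.1
  · refine (hX' ω s hs.1).trans ?_
    congr 1
    refine intervalIntegral.integral_congr fun r hr => ?_
    rw [uIcc_of_le hs.1] at hr
    exact hh r ⟨ht.1.trans hr.1, hr.2.trans hs.2⟩ _ _

theorem IsDynamics.intervalIntegrable (hf : IsDynamics f T M K) (ht : 0 ≤ t) {a : ℝ → U}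
    {b : ℝ → V} (ha : Measurable a) (hb : Measurable b) {X : ℝ → State d}
    (hX : ContinuousOn X (Icc t T)) {r s : ℝ} (hr : r ∈ Icc t T) (hs : s ∈ Icc t T) :
    IntervalIntegrable (fun s => f s (X s) (a s) (b s)) volume r s := by
  have hsub : uIoc r s ⊆ Icc t T := uIoc_subset_uIcc.trans (uIcc_subset_Icc hr hs)
  have h0 : ∀ s ∈ Icc t T, s ∈ Icc 0 T := fun s hs => ⟨ht.trans hs.1, hs.2⟩
  rw [intervalIntegrable_iff]
  have hXm : AEMeasurable X (volume.restrict (uIoc r s)) :=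
    (hX.mono hsub).aemeasurable measurableSet_uIoc
  have hm := hf.meas.comp_aemeasurable
    (aemeasurable_id.prodMk (hXm.prodMk (ha.aemeasurable.prodMk hb.aemeasurable)))
  have : IsFiniteMeasure ((volume : Measure ℝ).restrict (uIoc r s)) :=
    isFiniteMeasure_restrict.2 (by simp)
  refine Integrable.of_bound ?_ M ?_
  · refine (hm.congr ?_).aestronglyMeasurable
    filter_upwards [ae_restrict_mem measurableSet_uIoc] with q hq
    exact indicator_of_mem (h0 q (hsub hq)) (fun r => f r (X q) (a q) (b q))
  · filter_upwards [ae_restrict_mem measurableSet_uIoc] with q hq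
    exact hf.bound q (h0 q (hsub hq)) _ _ _

/-- Trajectories with the same controls depend in a Lipschitz way on the initial datum. -/
theorem IsDynamics.norm_trajectory_sub_le (hf : IsDynamics f T M K) (hM : 0 ≤ M) (ht : 0 ≤ t)
    (htt : t ≤ t') (ht' : t' ≤ T) {a : ℝ → U} {b : ℝ → V} (ha : Measurable a) (hb : Measurable b)
    {X X' : ℝ → State d} (hX : IsTrajectory f T t x a b X) (hX' : IsTrajectory f T t' x' a b X') :
    ‖X T - X' T‖ ≤ (‖x - x'‖ + M * (t' - t)) * Real.exp (K * T) := by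
  have hsub : Icc t' T ⊆ Icc t T := Icc_subset_Icc_left htt
  have ht1 : t ∈ Icc t T := ⟨le_rfl, htt.trans ht'⟩
  have ht2 : t' ∈ Icc t T := ⟨htt, ht'⟩
  have h0 : ∀ s ∈ Icc t T, s ∈ Icc 0 T := fun s hs => ⟨ht.trans hs.1, hs.2⟩
  have hcont : ContinuousOn (fun s => ‖X s - X' s‖) (Icc t' T) :=
    ((hX.1.mono hsub).sub hX'.1).norm
  -- Until t' only the first trajectory moves, with speed at most M; Grönwall's inequality starts
  -- from this gap at time t'.
  have hstart : ‖X t' - x'‖ ≤ ‖x - x'‖ + M * (t' - t) := by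
    have h1 : ‖∫ r in t..t', f r (X r) (a r) (b r)‖ ≤ M * |t' - t| := by
      refine intervalIntegral.norm_integral_le_of_norm_le_const fun r hr => ?_
      rw [uIoc_of_le htt] at hr
      exact hf.bound r (h0 r ⟨hr.1.le, hr.2.trans ht'⟩) _ _ _
    rw [abs_of_nonneg (sub_nonneg.2 htt)] at h1
    rw [hX.2 t' ht2, add_sub_right_comm]
    exact (norm_add_le _ _).trans (by gcongr)
  have hδ : 0 ≤ ‖x - x'‖ + M * (t' - t) :=
    add_nonneg (norm_nonneg _) (mul_nonneg hM (sub_nonneg.2 htt))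
  refine (le_mul_exp_of_le_add_integral ht' hcont (fun _ _ => norm_nonneg _) hδ K.2
    fun s hs => ?_).trans ?_
  · have hi := hf.intervalIntegrable ht ha hb hX.1 ht2 (hsub hs)
    have hi' := hf.intervalIntegrable (ht.trans htt) ha hb hX'.1 (⟨le_rfl, ht'⟩ : t' ∈ Icc t' T) hs
    have hdec : X s - X' s = (X t' - x') +
        ∫ r in t'..s, (f r (X r) (a r) (b r) - f r (X' r) (a r) (b r)) := by
      rw [intervalIntegral.integral_sub hi hi', hX.2 s (hsub hs), hX'.2 s hs, hX.2 t' ht2,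
        ← intervalIntegral.integral_add_adjacent_intervals
          (hf.intervalIntegrable ht ha hb hX.1 ht1 ht2) hi]
      abel
    rw [hdec, ← intervalIntegral.integral_const_mul]
    refine (norm_add_le _ _).trans (add_le_add hstart ?_)
    refine intervalIntegral.norm_integral_le_of_norm_le hs.1 (ae_of_all _ fun r hr => ?_) ?_
    · have hr' : r ∈ Icc t' T := ⟨hr.1.le, hr.2.trans hs.2⟩
      have := (hf.lipschitz r (h0 r (hsub hr')) (a r) (b r)).dist_le_mul (X r) (X' r)
      rwa [dist_eq_norm, dist_eq_norm] at this
    · refine (ContinuousOn.intervalIntegrable ?_).const_mul _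
      rw [uIcc_of_le hs.1]
      exact hcont.mono (Icc_subset_Icc_right hs.2)
  · refine mul_le_mul_of_nonneg_left (Real.exp_le_exp.2 ?_) hδ
    exact mul_le_mul_of_nonneg_left (by linarith) K.2

theorem IsDynamics.isTrajectory [Nonempty U] [Nonempty V] (hf : IsDynamics f T M K)
    (ht : t ∈ Icc 0 T) (x : State d) {a : ℝ → U} {b : ℝ → V} (ha : Measurable a)
    (hb : Measurable b) : IsTrajectory f T t x a b (trajectory f T t x a b) := by
  obtain ⟨X, -, hX⟩ := hf.exists_trajectory (Ω := Unit) (u := fun s _ => a s) (v := fun s _ => b s)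
    ht x (ha.comp measurable_fst) (hb.comp measurable_fst)
  exact trajectory_spec ⟨_, hX ()⟩

/-- Solutions are chosen separately for each ω. Uniqueness, the Lipschitz estimate with equal
initial data, identifies the choice with the measurable Picard solution. -/
theorem IsDynamics.measurable_trajectory [Nonempty U] [Nonempty V] (hf : IsDynamics f T M K)
    (ht : t ∈ Icc 0 T) (x : State d) {Ω : Type*} [MeasurableSpace Ω]
    {u : ℝ → Ω → U} {v : ℝ → Ω → V} (hu : Measurable fun p : ℝ × Ω => u p.1 p.2)
    (hv : Measurable fun p : ℝ × Ω => v p.1 p.2) :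
    Measurable fun ω => trajectory f T t x (fun s => u s ω) (fun s => v s ω) T := by
  obtain ⟨X, hX, hX'⟩ := hf.exists_trajectory ht x hu hv
  have hpath : ∀ ω : Ω, Measurable fun s : ℝ => (s, ω) := fun ω =>
    measurable_id.prodMk measurable_const
  have hXT : Measurable fun ω => X T ω := hX.comp (measurable_const.prodMk measurable_id)
  convert hXT using 1
  funext ω
  have := hf.norm_trajectory_sub_le (hf.nonneg (ht.1.trans ht.2)) ht.1 le_rfl ht.2
    (hu.comp (hpath ω)) (hv.comp (hpath ω)) (hX' ω) (trajectory_spec ⟨_, hX' ω⟩)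
  rw [sub_self, sub_self, norm_zero, mul_zero, add_zero, zero_mul] at this
  exact (sub_eq_zero.1 (norm_le_zero_iff.1 this)).symm

end Trajectories

/-! ### The values along a partition -/

section PartitionValues

variable {d : ℕ} {U V : Type*} [MeasurableSpace U] [MeasurableSpace V] [Nonempty U] [Nonempty V]
  {f : ℝ → State d → U → V → State d} {g : State d → ℝ} {T M C : ℝ} {Kf Kg : NNReal}
  {π : TimePartition T}

/-- The pay-off is defined by a chosen outcome; locality on the whole of Ω shows that any other
couple gives the same conditional expectation. -/
theorem isGamePayoff_condPayoff (hf : IsDynamics f T M Kf) (hC : ∀ x, |g x| ≤ C)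
    (hg : LipschitzWith Kg g) (t : Icc 0 T) (x : State d) :
    IsGamePayoff π t (π.index t) privateField₁ privateField₂
      (fun a b => g (trajectory f T t x a b T)) C (fun α β => condPayoff f g t x α β) where
  node_le := π.node_index_le t.2.1
  le_n := π.index_le t
  bound a b := hC _
  meas u v := (hg.continuous.measurable.comp
    (hf.measurable_trajectory t.2 x u.2.measurable v.2.measurable)).aestronglyMeasurable
  congr a a' b b' ha hb := by rw [trajectory_congr ha hb]
  exists_couple α β :=
    ⟨(outcome α β).1, (outcome α β).2, (exists_outcome t.2.1 α β).choose_spec⟩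
  ae_eq α β u v h := by
    have h0 : IsCouple α β (outcome α β).1 (outcome α β).2 :=
      (exists_outcome t.2.1 α β).choose_spec
    obtain ⟨hu, hv⟩ := h0.agreeOnSet (π.node_index_le t.2.1) (π.index_le t) MeasurableSet.univ
      (fun _ => ae_of_all _ fun _ _ _ _ => rfl) (fun _ => ae_of_all _ fun _ _ _ _ => rfl) h
    refine (AEEqFun.coeFn_mk _ _).trans (condExp_congr_ae ?_)
    filter_upwards [hu.ae_path, hv.ae_path] with ω h1 h2
    rw [payoff, trajectory_congr (h1 (mem_univ _)) (h2 (mem_univ _))]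

theorem randomLowerValue_ae_eq (hf : IsDynamics f T M Kf) (hC : ∀ x, |g x| ≤ C)
    (hg : LipschitzWith Kg g) (t : Icc 0 T) (x : State d) :
    ∀ᵐ ω ∂P, randomLowerValue f g π t x ω = lowerValue f g π t x :=
  (isGamePayoff_condPayoff hf hC hg t x).value_ae_eq_const isSymmetry_rotation₁
    isSymmetry_rotation₂

theorem neg_randomUpperValue (hf : IsDynamics f T M Kf) (hC : ∀ x, |g x| ≤ C)
    (hg : LipschitzWith Kg g) (t : Icc 0 T) (x : State d) :
    (essSupFamily fun β : Strategy₂ π (t : ℝ) U V =>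
      essInfFamily fun α : Strategy₁ π (t : ℝ) U V => -condPayoff f g t x α β) =
      -randomUpperValue f g π t x :=
  (isGamePayoff_condPayoff hf hC hg t x).value_swap_neg

theorem randomUpperValue_ae_eq (hf : IsDynamics f T M Kf) (hC : ∀ x, |g x| ≤ C)
    (hg : LipschitzWith Kg g) (t : Icc 0 T) (x : State d) :
    ∀ᵐ ω ∂P, randomUpperValue f g π t x ω = upperValue f g π t x := by
  have h := (isGamePayoff_condPayoff (π := π) hf hC hg t x).swap_neg.value_ae_eq_const
    isSymmetry_rotation₂ isSymmetry_rotation₁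
  rw [neg_randomUpperValue hf hC hg] at h
  have hneg := AEEqFun.coeFn_neg (randomUpperValue f g π t x)
  rw [integral_congr_ae hneg] at h
  filter_upwards [h, hneg] with ω h1 h2
  rw [h2] at h1
  simp only [Pi.neg_apply, integral_neg, neg_inj] at h1
  exact h1

/-- The difference of the pay-offs for the same control paths and different initial data. -/
theorem abs_payoff_sub_le (hf : IsDynamics f T M Kf) (hg : LipschitzWith Kg g) (t t' : Icc 0 T)
    (htt : t ≤ t') (x x' : State d) (a : ℝ → U) (b : ℝ → V) (ha : Measurable a)
    (hb : Measurable b) :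
    |g (trajectory f T t x a b T) - g (trajectory f T t' x' a b T)| ≤
      Kg * ((‖x - x'‖ + M * (t' - t)) * Real.exp (Kf * T)) := by
  have h := hg.dist_le_mul (trajectory f T t x a b T) (trajectory f T t' x' a b T)
  rw [Real.dist_eq, dist_eq_norm] at h
  refine h.trans (mul_le_mul_of_nonneg_left ?_ Kg.2)
  exact hf.norm_trajectory_sub_le (hf.nonneg (t.2.1.trans t.2.2)) t.2.1 htt t'.2.2 ha hb
    (hf.isTrajectory t.2 x ha hb) (hf.isTrajectory t'.2 x' ha hb)

theorem abs_lowerValue_sub_le (hf : IsDynamics f T M Kf) (hC : ∀ x, |g x| ≤ C)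
    (hg : LipschitzWith Kg g) (t t' : Icc 0 T) (htt : t ≤ t') (x x' : State d) :
    |lowerValue f g π t x - lowerValue f g π t' x'| ≤
      Kg * ((‖x - x'‖ + M * (t' - t)) * Real.exp (Kf * T)) :=
  (isGamePayoff_condPayoff hf hC hg t x).abs_value_sub_le
    (isGamePayoff_condPayoff hf hC hg t' x') htt (π.index_mono htt)
    (abs_payoff_sub_le hf hg t t' htt x x') (randomLowerValue_ae_eq hf hC hg t x)
    (randomLowerValue_ae_eq hf hC hg t' x')

theorem abs_upperValue_sub_le (hf : IsDynamics f T M Kf) (hC : ∀ x, |g x| ≤ C)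
    (hg : LipschitzWith Kg g) (t t' : Icc 0 T) (htt : t ≤ t') (x x' : State d) :
    |upperValue f g π t x - upperValue f g π t' x'| ≤
      Kg * ((‖x - x'‖ + M * (t' - t)) * Real.exp (Kf * T)) := by
  have hval : ∀ (t : Icc 0 T) (x : State d), ∀ᵐ ω ∂P,
      (essSupFamily fun β : Strategy₂ π (t : ℝ) U V =>
        essInfFamily fun α : Strategy₁ π (t : ℝ) U V => -condPayoff f g t x α β) ω =
        -upperValue f g π t x := by
    intro t x
    rw [neg_randomUpperValue hf hC hg]
    filter_upwards [AEEqFun.coeFn_neg (randomUpperValue f g π t x),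
      randomUpperValue_ae_eq (π := π) hf hC hg t x] with ω h1 h2
    rw [h1, Pi.neg_apply, h2]
  have := (isGamePayoff_condPayoff hf hC hg t x).swap_neg.abs_value_sub_le
    (isGamePayoff_condPayoff hf hC hg t' x').swap_neg htt (π.index_mono htt)
    (fun b a hb ha => by
      rw [← neg_sub', abs_neg]
      exact abs_payoff_sub_le hf hg t t' htt x x' a b ha hb) (hval t x) (hval t' x')
  rwa [← neg_sub', abs_neg] at this

theorem abs_values_sub_le (hf : IsDynamics f T M Kf) (hC : ∀ x, |g x| ≤ C)
    (hg : LipschitzWith Kg g) (t t' : Icc 0 T) (x x' : State d) :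
    |lowerValue f g π t x - lowerValue f g π t' x'|
      + |upperValue f g π t x - upperValue f g π t' x'|
      ≤ 2 * Kg * Real.exp (Kf * T) * (1 + |M|) * (|(t : ℝ) - t'| + ‖x - x'‖) := by
  wlog htt : t ≤ t' generalizing t t' x x'
  · have := this t' t x' x (le_of_not_ge htt)
    rwa [abs_sub_comm (lowerValue f g π t' x'), abs_sub_comm (upperValue f g π t' x'),
      abs_sub_comm (t' : ℝ), norm_sub_rev x'] at this
  refine (add_le_add (abs_lowerValue_sub_le hf hC hg t t' htt x x')
    (abs_upperValue_sub_le hf hC hg t t' htt x x')).trans ?_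
  have h1 : (0 : ℝ) ≤ t' - t := sub_nonneg.2 htt
  rw [abs_sub_comm (t : ℝ), abs_of_nonneg h1]
  -- The factor 1 + |M| dominates both coefficients, 1 and M; the factor 2 in the constant counts
  -- the two values.
  have h2 : ‖x - x'‖ + M * ((t' : ℝ) - t) ≤ (1 + |M|) * ((t' - t) + ‖x - x'‖) := by
    have h3 := mul_le_mul_of_nonneg_right (le_abs_self M) h1
    have h4 := mul_nonneg (abs_nonneg M) (norm_nonneg (x - x'))
    linarith
  have h5 := mul_le_mul_of_nonneg_left h2
    (mul_nonneg (mul_nonneg zero_le_two Kg.2) (Real.exp_pos (Kf * T)).le)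
  refine le_trans (le_of_eq ?_) (h5.trans_eq ?_) <;> rw [NNReal.val_eq_coe] <;> ring

end PartitionValues

/-- Compact metric spaces are second countable, so the product σ-field contains the open sets of the
product and continuity on the slab gives joint measurability. -/
theorem isDynamics_of_continuousOn {d : ℕ} {U V : Type*}
    [MetricSpace U] [CompactSpace U] [MeasurableSpace U] [BorelSpace U]
    [MetricSpace V] [CompactSpace V] [MeasurableSpace V] [BorelSpace V]
    {f : ℝ → State d → U → V → State d} {T M : ℝ} {K : NNReal}
    (hc : ContinuousOn (fun p : ℝ × State d × U × V => f p.1 p.2.1 p.2.2.1 p.2.2.2)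
      (Icc 0 T ×ˢ univ))
    (hb : ∀ s ∈ Icc 0 T, ∀ x a b, ‖f s x a b‖ ≤ M)
    (hl : ∀ s ∈ Icc 0 T, ∀ a b, LipschitzWith K fun x => f s x a b) : IsDynamics f T M K where
  meas := by
    classical
    have h := hc.measurable_piecewise (g := fun _ => 0) continuousOn_const
      (measurableSet_Icc.prod MeasurableSet.univ)
    convert h using 1
    funext p
    by_cases hp : p.1 ∈ Icc 0 T
    · rw [indicator_of_mem hp, piecewise_eq_of_mem _ _ _ (mk_mem_prod hp (mem_univ p.2))]
    · rw [indicator_of_notMem hp, piecewise_eq_of_notMem _ _ _ fun h => hp h.1]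
  bound := hb
  lipschitz := hl

end MixedGame

/-! ### The Lipschitz estimate for the random and the deterministic values -/

theorem lemma3p5 (T : ℝ) (hT : 0 < T) (M : ℝ) (Kf Kg : NNReal) :
    ∃ L : ℝ, ∀ (d : ℕ)
      (U : Type*) [MetricSpace U] [CompactSpace U] [Nonempty U] [MeasurableSpace U] [BorelSpace U]
      (V : Type*) [MetricSpace V] [CompactSpace V] [Nonempty V] [MeasurableSpace V] [BorelSpace V]
      (f : ℝ → MixedGame.State d → U → V → MixedGame.State d) (g : MixedGame.State d → ℝ),
      ContinuousOn (fun p : ℝ × MixedGame.State d × U × V => f p.1 p.2.1 p.2.2.1 p.2.2.2)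
        (Set.Icc 0 T ×ˢ Set.univ) →
      (∀ s ∈ Set.Icc 0 T, ∀ x a b, ‖f s x a b‖ ≤ M) →
      (∀ s ∈ Set.Icc 0 T, ∀ a b, LipschitzWith Kf (fun x => f s x a b)) →
      (∃ C : ℝ, ∀ x, |g x| ≤ C) →
      LipschitzWith Kg g →
      ∀ (π : MixedGame.TimePartition T) (t t' : Set.Icc 0 T) (x x' : MixedGame.State d),
        (∀ᵐ ω ∂MixedGame.P,
          |MixedGame.randomLowerValue f g π t x ω - MixedGame.randomLowerValue f g π t' x' ω|
            + |MixedGame.randomUpperValue f g π t x ω - MixedGame.randomUpperValue f g π t' x' ω|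
            ≤ L * (|(t : ℝ) - t'| + ‖x - x'‖)) ∧
        |MixedGame.lowerValue f g π t x - MixedGame.lowerValue f g π t' x'|
          + |MixedGame.upperValue f g π t x - MixedGame.upperValue f g π t' x'|
          ≤ L * (|(t : ℝ) - t'| + ‖x - x'‖) := by
  refine ⟨2 * Kg * Real.exp (Kf * T) * (1 + |M|), ?_⟩
  intro d U _ _ _ _ _ V _ _ _ _ _ f g hc hb hl hC hg π t t' x x'
  obtain ⟨C, hC⟩ := hC
  have hf := MixedGame.isDynamics_of_continuousOn hc hb hl
  have h := MixedGame.abs_values_sub_le (π := π) hf hC hg t t' x x'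
  refine ⟨?_, h⟩
  -- The four random values coincide almost surely with their means, so the random inequality is the
  -- deterministic one.
  filter_upwards [MixedGame.randomLowerValue_ae_eq (π := π) hf hC hg t x,
    MixedGame.randomLowerValue_ae_eq (π := π) hf hC hg t' x',
    MixedGame.randomUpperValue_ae_eq (π := π) hf hC hg t x,
    MixedGame.randomUpperValue_ae_eq (π := π) hf hC hg t' x'] with ω h1 h2 h3 h4
  rw [h1, h2, h3, h4]
  exact h
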